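/- **Setting.** Let $I,L,d_x,d_z\in\mathbb N_0$. For $i=0,\dots,I$ let $f_i:\mathbb R^{d_x}\times\mathbb R^{d_z}\to\overline{\mathbb R}$ be such that $f_i(\cdot,z)$ is proper, closed and convex for every fixed $z$ and $-f_i(x,\cdot)$ is proper, closed and convex for every fixed $x$. For $\ell=1,\dots,L$ let $c_\ell:\mathbb R^{d_z}\to\overline{\mathbb R}$ be proper, closed and convex, and suppose that the uncertainty set $\mathcal Z=\{z\in\mathbb R^{d_z}: c_\ell(z)\le 0,\ \ell=1,\dots,L\}$ is nonempty. (A function is proper if it is nowhere $-\infty$ and not identically $+\infty$; closed if it is lower semicontinuous and either nowhere or everywhere $-\infty$; convex if its epigraph is convex. For $h$ with values in $\overline{\mathbb R}$, $\operatorname{dom}h=\{h<+\infty\}$, and $\operatorname{ri}$ denotes the relative interior.) Let $f_i^{*1}(w,z)=\sup_{x}\{w^\top x-f_i(x,z)\}$, and let $\lambda f_i^{*1}(w/\lambda,z)$ denote its convex partial perspective: the literal expression for $\lambda>0$; for $\lambda=0$ the value at $w$ of the support function of the domain of the conjugate of $f_i^{*1}(\cdot,z)$; and $+\infty$ for $\lambda<0$.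 The *primal worst problem* is $$\text{(P-W)}\qquad \inf_{x\in\mathbb R^{d_x}}\ \sup_{z_0\in\mathcal Z}f_0(x,z_0)\quad\text{s.t.}\quad \sup_{z_i\in\mathcal Z}f_i(x,z_i)\le 0,\ \ i=1,\dots,I,$$ and the *dual best problem* is $$\text{(D-B)}\qquad \sup_{w,z,\lambda}\ -f_0^{*1}(w_0,z_0)-\sum_{i=1}^I\lambda_i f_i^{*1}(w_i/\lambda_i,z_i)\quad\text{s.t.}\quad \sum_{i=0}^I w_i=0,\quad c_\ell(z_i)\le 0\ \ (0\le i\le I,\ 1\le\ell\le L),\quad -\lambda_i\le 0\ \ (1\le i\le I),$$ with variables $w_0,\dots,w_I\in\mathbb R^{d_x}$, $z_0,\dots,z_I\in\mathbb R^{d_z}$, $\lambda\in\mathbb R^I$. A point is *feasible* in a minimization (maximization) problem if it satisfies all constraints and its objective value is not $+\infty$ (not $-\infty$); the *feasible region* is the set of feasible points. A problem is *solvable* if it has no feasible point (by convention) or if its optimal value is attained at a feasible point. A *strict Slater point* of a problem with constraints $g_k\le 0$, $h_j=0$ is a point that satisfies all constraints, satisfies $g_k<0$ for every $k$, and lies in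 $\operatorname{ri}(\operatorname{dom}g_k)$ and $\operatorname{ri}(\operatorname{dom}h_j)$ for all $k,j$ and in $\operatorname{ri}(\operatorname{dom}g_0)$ for a minimization problem, or $\operatorname{ri}(\operatorname{dom}(-g_0))$ for a maximization problem, with objective function $g_0$. (For (P-W) the constraint functions are $x\mapsto\sup_{z\in\mathcal Z}f_i(x,z)$.) **Theorem (strong duality for (P-W) and (D-B)).** 1. If (P-W) admits a strict Slater point and $\mathcal Z$ is bounded, then the infimum of (P-W) equals the supremum of (D-B) (in $\overline{\mathbb R}$), and (D-B) is solvable. 2. If the feasible region of (P-W) is nonempty and bounded and $\mathcal Z$ is bounded, then the infimum of (P-W) equals the supremum of (D-B), and (P-W) is solvable. 3. If (D-B) admits a strict Slater point (with $\mathcal Z$ possibly unbounded), then the infimum of (P-W) equals the supremum of (D-B), and (P-W) is solvable. -/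

import Mathlib

noncomputable section

namespace RobustDuality

/-- The Euclidean space of dimension `d`. -/
abbrev Vec (d : ℕ) : Type := EuclideanSpace ℝ (Fin d)

/-! ### Extended real-valued convex analysis -/

section ConvexAnalysis

/-- The (effective) domain of an extended real-valued function. -/
def dom {E : Type*} (f : E → EReal) : Set E := {x | f x < ⊤}

/-- A function is proper if it never takes the value `-∞` and is not identically `+∞`. -/
def IsProper {E : Type*} (f : E → EReal) : Prop := (∀ x, ⊥ < f x) ∧ ∃ x, f x < ⊤

/-- A function is closed if it is lower semicontinuous and either nowhere or everywhere `-∞`. -/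
def IsClosedFun {E : Type*} [TopologicalSpace E] (f : E → EReal) : Prop :=
  LowerSemicontinuous f ∧ ((∀ x, ⊥ < f x) ∨ ∀ x, f x = ⊥)

/-- An extended real-valued function is convex if its epigraph is a convex set. -/
def IsConvexFun {E : Type*} [AddCommGroup E] [Module ℝ E] (f : E → EReal) : Prop :=
  Convex ℝ {p : E × ℝ | f p.1 ≤ (p.2 : EReal)}

/-- Proper, closed and convex. -/
def IsPCC {E : Type*} [AddCommGroup E] [Module ℝ E] [TopologicalSpace E] (f : E → EReal) : Prop :=
  IsProper f ∧ IsClosedFun f ∧ IsConvexFun f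

/-- The conjugate `f^*(w) = sup_x (xᵀ w - f x)`. -/
def conj {d : ℕ} (f : Vec d → EReal) (w : Vec d) : EReal :=
  ⨆ x : Vec d, ((inner ℝ x w : ℝ) : EReal) - f x

/-- The support function `sup_{x ∈ X} xᵀ w` of a set `X`. -/
def supportFun {d : ℕ} (X : Set (Vec d)) (w : Vec d) : EReal :=
  ⨆ x ∈ X, ((inner ℝ x w : ℝ) : EReal)

/-- The convex perspective of `f`: it is `t f(x / t)` for `t > 0`, and for `t = 0` it is the
support function of the domain of the conjugate of `f`.  As a function on all of
`ℝ^d × ℝ` it is extended by `+∞` to negative values of `t`. -/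
def perspective {d : ℕ} (f : Vec d → EReal) (x : Vec d) (t : ℝ) : EReal :=
  if 0 < t then (t : EReal) * f (t⁻¹ • x)
  else if t = 0 then supportFun (dom (conj f)) x
  else ⊤

/-- The partial conjugate of `f(x, z)` with respect to its first argument. -/
def partialConj {dx dz : ℕ} (f : Vec dx → Vec dz → EReal) (w : Vec dx) (z : Vec dz) : EReal :=
  conj (fun x => f x z) w

/-- The partial perspective, in the first argument, of the partial conjugate of `f`: this is
`t f^{*1}(w / t, z)`. -/
def partialConjPerspective {dx dz : ℕ} (f : Vec dx → Vec dz → EReal)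
    (w : Vec dx) (t : ℝ) (z : Vec dz) : EReal :=
  perspective (fun w' => partialConj f w' z) w t

end ConvexAnalysis

/-! ### Optimization problems in functional form -/

section Programs

/-- The data of an optimization problem over `E`: an objective, inequality constraints
`ineq i x ≤ 0` and equality constraints `eqn j x = 0`.  It can be read as a minimization or as a
maximization problem. -/
structure Program (E ι κ : Type*) where
  obj : E → EReal
  ineq : ι → E → EReal
  eqn : κ → E → EReal

variable {E ι κ : Type*}

/-- The points that satisfy all constraints. -/
def Program.constraintSet (P : Program E ι κ) : Set E :=
  {x | (∀ i, P.ineq i x ≤ 0) ∧ ∀ j, P.eqn j x = 0}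

/-- The infimum of the minimization problem. -/
def Program.infimum (P : Program E ι κ) : EReal := ⨅ x ∈ P.constraintSet, P.obj x

/-- The supremum of the maximization problem. -/
def Program.supremum (P : Program E ι κ) : EReal := ⨆ x ∈ P.constraintSet, P.obj x

/-- The feasible region of the minimization problem: all constraints hold and the objective is
not `+∞`. -/
def Program.minFeasible (P : Program E ι κ) : Set E := {x ∈ P.constraintSet | P.obj x ≠ ⊤}

/-- The feasible region of the maximization problem: all constraints hold and the objective is
not `-∞`. -/
def Program.maxFeasible (P : Program E ι κ) : Set E := {x ∈ P.constraintSet | P.obj x ≠ ⊥}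

/-- A feasible minimization problem is solvable if its optimal value is attained by a feasible
point; an infeasible one is solvable by convention. -/
def Program.MinSolvable (P : Program E ι κ) : Prop :=
  P.minFeasible.Nonempty → ∃ x ∈ P.minFeasible, P.obj x = P.infimum

/-- A feasible maximization problem is solvable if its optimal value is attained by a feasible
point; an infeasible one is solvable by convention. -/
def Program.MaxSolvable (P : Program E ι κ) : Prop :=
  P.maxFeasible.Nonempty → ∃ x ∈ P.maxFeasible, P.obj x = P.supremum

/-- `x` is a strict Slater point of the constraint set: it is in the relative interior of
the domain of every constraint function, it satisfies all constraints, and it satisfies all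
inequality constraints strictly. -/
def Program.IsStrictSlaterSet [AddCommGroup E] [Module ℝ E] [TopologicalSpace E]
    (P : Program E ι κ) (x : E) : Prop :=
  (∀ i, x ∈ intrinsicInterior ℝ (dom (P.ineq i))) ∧
  (∀ j, x ∈ intrinsicInterior ℝ (dom (P.eqn j))) ∧
  x ∈ P.constraintSet ∧
  ∀ i, P.ineq i x < 0

/-- Strict Slater points of the minimization problem. -/
def Program.IsMinStrictSlater [AddCommGroup E] [Module ℝ E] [TopologicalSpace E]
    (P : Program E ι κ) (x : E) : Prop :=
  P.IsStrictSlaterSet x ∧ x ∈ intrinsicInterior ℝ (dom P.obj)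

/-- Strict Slater points of the maximization problem. -/
def Program.IsMaxStrictSlater [AddCommGroup E] [Module ℝ E] [TopologicalSpace E]
    (P : Program E ι κ) (x : E) : Prop :=
  P.IsStrictSlaterSet x ∧ x ∈ intrinsicInterior ℝ (dom fun y => -P.obj y)

end Programs

/-! ### The robust problem and its dual -/

section Robust

/-- The uncertainty set `{z | c_ℓ(z) ≤ 0 for all ℓ}`. -/
def uncertaintySet {L dz : ℕ} (c : Fin L → Vec dz → EReal) : Set (Vec dz) :=
  {z | ∀ l, c l z ≤ 0}

/-- The worst case `x ↦ sup_{z ∈ Z} f(x, z)`. -/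
def worstCase {dx dz : ℕ} (Z : Set (Vec dz)) (f : Vec dx → Vec dz → EReal) (x : Vec dx) : EReal :=
  ⨆ z ∈ Z, f x z

/-- The primal worst problem (to be minimized): objective `sup_{z ∈ Z} f_0(x, z)`, constraints
`sup_{z ∈ Z} f_i(x, z) ≤ 0` for `i = 1, …, I`. -/
def primalWorst {I L dx dz : ℕ} (f : Fin (I + 1) → Vec dx → Vec dz → EReal)
    (c : Fin L → Vec dz → EReal) : Program (Vec dx) (Fin I) Empty where
  obj := worstCase (uncertaintySet c) (f 0)
  ineq i := worstCase (uncertaintySet c) (f i.succ)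
  eqn := Empty.elim

/-- The decision variables `((w_i)_{i = 0..I}, (z_i)_{i = 0..I}, (λ_i)_{i = 1..I})` of the dual
best problem. -/
abbrev DualVar (I dx dz : ℕ) : Type := (Fin (I + 1) → Vec dx) × (Fin (I + 1) → Vec dz) × (Fin I → ℝ)

/-- The dual best problem (to be maximized): the objective is
`- f_0^{*1}(w_0, z_0) - ∑_i λ_i f_i^{*1}(w_i / λ_i, z_i)`; the inequality constraints are
`-λ_i ≤ 0` for `i = 1, …, I` and `c_ℓ(z_i) ≤ 0` for `i = 0, …, I` and all `ℓ`; the equality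
constraints are the coordinates of `∑_i w_i = 0`. -/
def dualBest {I L dx dz : ℕ} (f : Fin (I + 1) → Vec dx → Vec dz → EReal)
    (c : Fin L → Vec dz → EReal) :
    Program (DualVar I dx dz) (Fin I ⊕ (Fin (I + 1) × Fin L)) (Fin dx) where
  obj := fun (w, z, lam) =>
    - partialConj (f 0) (w 0) (z 0)
      - ∑ i : Fin I, partialConjPerspective (f i.succ) (w i.succ) (lam i) (z i.succ)
  ineq := Sum.elim
    (fun i (_, _, lam) => ((-lam i : ℝ) : EReal))
    (fun p (_, z, _) => c p.2 (z p.1))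
  eqn := fun k (w, _, _) => (((∑ i, w i) k : ℝ) : EReal)

end Robust

end RobustDuality

end

/-! Properness in both arguments forces every `f i` to be real-valued, so the primal functions are
ordinary convex functions and a real lower bound on the dual objective unfolds into finitely many
affine inequalities (`coe_le_dualBest_obj_iff`). Weak duality is then a summation of these
inequalities at a primal point.

Let the uncertainty set be compact. The worst cases are real-valued, convex and attained.
Multipliers `l` with Lagrangian bounded below by `m` give a dual point of value at least `m`
(`exists_dualBest_of_multipliers`): Sion's theorem picks one tuple of scenarios that works for all
`x`, and Fenchel duality splits the resulting sum into the `w i`. A Slater point supplies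
multipliers at the optimal value itself, hence dual attainment. A nonempty bounded feasible region
supplies them for every smaller value, which closes the gap, while primal attainment is Weierstrass.

With a dual Slater point compactness is not needed. The pairs (residual `∑ w i`, lower bound on the
dual objective) form a convex set `dualImage`, and the Slater point makes its projection absorbing
around `0`. A linear functional dominating it is, up to sign, a primal point; testing it against
subgradients shows that this point is feasible and optimal.

All separation rests on the algebraic statement `exists_linear_bound`, which uses no topology. -/

noncomputable section

namespace RobustDuality

open Set Filter Topology
open scoped Pointwise

/-! ### Separation and duality for real-valued convex functions -/

section RealConvex

/-- If the projection of a convex set `K ⊆ V × ℝ` to `V` is absorbing in its span and the fibre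
over `0` is bounded above by `v`, then `K` lies below an affine function with value `v` at `0`. -/
theorem exists_linear_bound {V : Type*} [AddCommGroup V] [Module ℝ V] {K : Set (V × ℝ)}
    (hK : Convex ℝ K) {v r₀ : ℝ} (h₀ : ((0 : V), r₀) ∈ K)
    (hv : ∀ r, ((0 : V), r) ∈ K → r ≤ v)
    (hcore : ∀ p ∈ K, ∃ s > (0 : ℝ), ∃ r, (-(s • p.1), r) ∈ K) :
    ∃ φ : V →ₗ[ℝ] ℝ, ∀ p ∈ K, p.2 ≤ v + φ p.1 := by
  have hcomb : ∀ p ∈ K, ∀ q ∈ K, ∀ a b : ℝ, 0 ≤ a → 0 ≤ b →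
      ∃ k ∈ K, a • p + b • q = (a + b) • k := by
    intro p hp q hq a b ha hb
    have := hK.add_smul ha hb
    have h : a • p + b • q ∈ (a + b) • K := by
      rw [this]; exact add_mem_add (smul_mem_smul_set hp) (smul_mem_smul_set hq)
    obtain ⟨k, hk, e⟩ := h
    exact ⟨k, hk, e.symm⟩
  -- The conic hull of the projection is closed under negation because of `hcore`, so it is a
  -- subspace.
  let U : Submodule ℝ V :=
    { carrier := {u | ∃ t : ℝ, 0 ≤ t ∧ ∃ p ∈ K, u = t • p.1}
      zero_mem' := ⟨0, le_rfl, _, h₀, by simp⟩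
      add_mem' := by
        rintro _ _ ⟨a, ha, p, hp, rfl⟩ ⟨b, hb, q, hq, rfl⟩
        obtain ⟨k, hk, e⟩ := hcomb p hp q hq a b ha hb
        exact ⟨a + b, add_nonneg ha hb, k, hk, congrArg Prod.fst e⟩
      smul_mem' := by
        rintro c _ ⟨a, ha, p, hp, rfl⟩
        rcases le_or_gt 0 c with hc | hc
        · exact ⟨c * a, mul_nonneg hc ha, p, hp, by rw [mul_smul]⟩
        · obtain ⟨s, hs, r, hr⟩ := hcore p hp
          refine ⟨-c * a / s, by have := neg_pos.2 hc; positivity, _, hr, ?_⟩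
          simp only [smul_smul, ← neg_smul]
          congr 1
          field_simp }
  -- The cone generated by the points `(p.1, y)` with `y ≥ v - p.2`. By `hv` the second coordinate
  -- is nonnegative on its intersection with `{0} × ℝ`; a Riesz extension of it has the form `φ +
  -- snd`, and nonnegativity at `(p.1, v - p.2)` is the claim.
  let S : PointedCone ℝ (U × ℝ) :=
    { carrier := {y | ∃ t : ℝ, 0 ≤ t ∧ ∃ p ∈ K, (y.1 : V) = t • p.1 ∧ t * (v - p.2) ≤ y.2}
      zero_mem' := ⟨0, le_rfl, _, h₀, by simp⟩
      add_mem' := by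
        rintro y z ⟨a, ha, p, hp, e1, l1⟩ ⟨b, hb, q, hq, e2, l2⟩
        obtain ⟨k, hk, e⟩ := hcomb p hp q hq a b ha hb
        have e' : a * p.2 + b * q.2 = (a + b) * k.2 := congrArg Prod.snd e
        refine ⟨a + b, add_nonneg ha hb, k, hk, ?_, ?_⟩
        · rw [← show a • p.1 + b • q.1 = (a + b) • k.1 from congrArg Prod.fst e, ← e1, ← e2]
          simp
        · have : (y + z).2 = y.2 + z.2 := rfl
          rw [this]
          nlinarith
      smul_mem' := by
        rintro c y ⟨a, ha, p, hp, e1, l1⟩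
        refine ⟨c * a, mul_nonneg c.2 ha, p, hp, ?_, ?_⟩
        · rw [mul_smul, ← e1]; rfl
        · have : (c • y).2 = (c : ℝ) * y.2 := rfl
          rw [this, mul_assoc]
          exact mul_le_mul_of_nonneg_left l1 c.2 }
  let D : Submodule ℝ (U × ℝ) := LinearMap.range (LinearMap.inr ℝ U ℝ)
  obtain ⟨g, hg, hgS⟩ := riesz_extension S ⟨D, (LinearMap.snd ℝ U ℝ).domRestrict D⟩
    (by
      rintro ⟨_, τ, rfl⟩ ⟨t, ht, p, hp, e, l⟩
      change 0 ≤ τ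
      simp only [LinearMap.inr_apply, ZeroMemClass.coe_zero] at e l
      rcases ht.eq_or_lt with rfl | ht
      · simpa using l
      · have hp1 : p.1 = 0 := (smul_eq_zero.1 e.symm).resolve_left ht.ne'
        have := hv p.2 (by rw [← hp1]; exact hp)
        nlinarith)
    (by
      rintro ⟨⟨u, t, ht, p, hp, e⟩, τ⟩
      refine ⟨⟨(0, t * (v - p.2) - τ), ⟨_, rfl⟩⟩, t, ht, p, hp, ?_, ?_⟩
      · simpa using e
      · simp)
  obtain ⟨φ, hφ⟩ := LinearMap.exists_extend (g ∘ₗ LinearMap.inl ℝ U ℝ)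
  refine ⟨φ, fun p hp => ?_⟩
  have hpU : p.1 ∈ U := ⟨1, zero_le_one, p, hp, by simp⟩
  have h1 : 0 ≤ g (⟨p.1, hpU⟩, v - p.2) := hgS _ ⟨1, zero_le_one, p, hp, by simp, by simp⟩
  have h2 : g ((0 : U), v - p.2) = v - p.2 := hg ⟨(0, v - p.2), ⟨_, rfl⟩⟩
  have h3 : φ p.1 = g (⟨p.1, hpU⟩, 0) := by
    have := LinearMap.congr_fun hφ ⟨p.1, hpU⟩
    simpa using this
  have h4 : ((⟨p.1, hpU⟩ : U), v - p.2) = (⟨p.1, hpU⟩, 0) + (0, v - p.2) := by simp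
  rw [h4, map_add, h2, ← h3] at h1
  linarith

/-- Lagrange multipliers for a convex program with a Slater point. -/
theorem exists_lagrange_multiplier {V : Type*} [AddCommGroup V] [Module ℝ V] {n : ℕ}
    {F₀ : V → ℝ} {F : Fin n → V → ℝ} (h₀ : ConvexOn ℝ univ F₀) (hF : ∀ i, ConvexOn ℝ univ (F i))
    {x₀ : V} (hx₀ : ∀ i, F i x₀ < 0) {m : ℝ} (hm : ∀ x, (∀ i, F i x ≤ 0) → m ≤ F₀ x) :
    ∃ l : Fin n → ℝ, (∀ i, 0 ≤ l i) ∧ ∀ x, m ≤ F₀ x + ∑ i, l i * F i x := by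
  -- Perturb the right-hand sides of the constraints: `K` lies under the graph of minus the value
  -- function. The Slater point makes every small perturbation admissible, in all directions.
  let K : Set ((Fin n → ℝ) × ℝ) := {p | ∃ x, (∀ i, F i x ≤ p.1 i) ∧ F₀ x ≤ -p.2}
  have hK : Convex ℝ K := by
    rintro p ⟨x, hx, hx'⟩ q ⟨y, hy, hy'⟩ a b ha hb hab
    refine ⟨a • x + b • y, fun i => ?_, ?_⟩
    · refine ((hF i).2 trivial trivial ha hb hab).trans ?_
      simp only [smul_eq_mul, Prod.fst_add, Prod.smul_fst, Pi.add_apply, Pi.smul_apply]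
      gcongr
      exacts [hx i, hy i]
    · refine (h₀.2 trivial trivial ha hb hab).trans ?_
      simp only [smul_eq_mul, Prod.snd_add, Prod.smul_snd]
      nlinarith
  have hu : ∀ u : Fin n → ℝ, ∃ s > (0 : ℝ), ∃ r, (-(s • u), r) ∈ K := by
    intro u
    have h1 : ∀ i, ∀ᶠ s : ℝ in 𝓝[>] 0, F i x₀ ≤ -(s * u i) := by
      intro i
      have : Tendsto (fun s : ℝ => -(s * u i)) (𝓝[>] 0) (𝓝 (-(0 * u i))) :=
        (Continuous.tendsto (by fun_prop) 0).mono_left nhdsWithin_le_nhds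
      exact (this.eventually (lt_mem_nhds (by simpa using hx₀ i))).mono fun s hs => hs.le
    obtain ⟨s, hs, hs'⟩ := ((eventually_all.2 h1).and self_mem_nhdsWithin).exists
    exact ⟨s, hs', -F₀ x₀, x₀, by simpa using hs, by simp⟩
  obtain ⟨φ, hφ⟩ := exists_linear_bound (v := -m) (r₀ := -F₀ x₀) hK
    ⟨x₀, fun i => (hx₀ i).le, by simp⟩
    (by
      rintro r ⟨x, hx, hx'⟩
      have := hm x hx
      simp only at hx'
      linarith)
    (fun p _ => hu p.1)
  have hrep : ∀ u : Fin n → ℝ, φ u = ∑ i, φ (Pi.single i 1) * u i := by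
    intro u
    conv_lhs => rw [← Finset.univ_sum_single u, map_sum]
    refine Finset.sum_congr rfl fun i _ => ?_
    rw [mul_comm, ← smul_eq_mul, ← map_smul, ← Pi.single_smul, smul_eq_mul, mul_one]
  refine ⟨fun i => φ (Pi.single i 1), fun i => ?_, fun x => ?_⟩
  · by_contra hneg
    push Not at hneg
    set c := φ (Pi.single i 1)
    have key : ∀ t : ℝ, 0 ≤ t → -F₀ x₀ ≤ -m + t * c := by
      intro t ht
      have := hφ (t • Pi.single i 1, -F₀ x₀) ⟨x₀, fun j => (hx₀ j).le.trans ?_, by simp⟩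
      · simpa [c] using this
      · simp only [Pi.smul_apply, smul_eq_mul]
        exact mul_nonneg ht (by by_cases h : j = i <;> simp [h])
    have h0 := key 0 le_rfl
    -- Relaxing constraint `i` keeps `x₀` admissible, so a negative slope `c` would push the bound
    -- below `-F₀ x₀`; this step length overshoots by exactly `1`.
    have h1 := key ((F₀ x₀ - m + 1) / -c) (div_nonneg (by linarith) (by linarith))
    have : (F₀ x₀ - m + 1) / -c * c = -(F₀ x₀ - m + 1) := by
      field_simp [hneg.ne]
    linarith
  · have := hφ (fun i => F i x, -F₀ x) ⟨x, fun i => le_rfl, by simp⟩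
    rw [hrep] at this
    simp only at this
    linarith

/-- If a sum of functions of independent variables is bounded above, the bound splits. -/
theorem exists_sum_bound {X : Type*} [Nonempty X] {n : ℕ} {h : Fin n → X → ℝ} {M : ℝ}
    (hM : ∀ x : Fin n → X, ∑ i, h i (x i) ≤ M) :
    ∃ τ : Fin n → ℝ, (∀ i x, h i x ≤ τ i) ∧ ∑ i, τ i ≤ M := by
  classical
  obtain ⟨x₀⟩ := ‹Nonempty X›
  have hb : ∀ i, BddAbove (range (h i)) := by
    intro i
    refine ⟨M - ∑ j ∈ Finset.univ.erase i, h j x₀, ?_⟩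
    rintro _ ⟨x, rfl⟩
    have := hM (Function.update (fun _ => x₀) i x)
    rw [← Finset.add_sum_erase _ _ (Finset.mem_univ i)] at this
    have h2 : ∑ j ∈ Finset.univ.erase i, h j (Function.update (fun _ => x₀) i x j)
        = ∑ j ∈ Finset.univ.erase i, h j x₀ :=
      Finset.sum_congr rfl fun j hj => by
        rw [Function.update_of_ne (Finset.ne_of_mem_erase hj)]
    rw [h2, Function.update_self] at this
    linarith
  refine ⟨fun i => ⨆ x, h i x, fun i x => le_ciSup (hb i) x, ?_⟩
  refine le_of_forall_pos_le_add fun ε hε => ?_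
  have : Nonempty X := ⟨x₀⟩
  have hx : ∀ i, ∃ x, (⨆ x, h i x) - ε / (n + 1) < h i x := fun i =>
    exists_lt_of_lt_ciSup (sub_lt_self _ (by positivity))
  choose x hx using hx
  have h1 : ∑ i, (⨆ x, h i x) ≤ ∑ i, (h i (x i) + ε / (n + 1)) :=
    Finset.sum_le_sum fun i _ => by linarith [hx i]
  have h2 : (n : ℝ) * (ε / (n + 1)) ≤ ε := by
    rw [mul_div_assoc', div_le_iff₀ (by positivity)]
    nlinarith
  rw [Finset.sum_add_distrib, Finset.sum_const, Finset.card_univ, Fintype.card_fin,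
    nsmul_eq_mul] at h1
  linarith [hM x]

theorem exists_inner_rep {d : ℕ} (φ : Vec d →ₗ[ℝ] ℝ) : ∃ w : Vec d, ∀ x, φ x = inner ℝ x w := by
  refine ⟨(InnerProductSpace.toDual ℝ (Vec d)).symm φ.toContinuousLinearMap, fun x => ?_⟩
  rw [real_inner_comm, InnerProductSpace.toDual_symm_apply]
  rfl

/-- Fenchel duality for a sum of real-valued convex functions. -/
theorem exists_fenchel {d n : ℕ} {g : Fin n → Vec d → ℝ} (hg : ∀ i, ConvexOn ℝ univ (g i))
    {m : ℝ} (hm : ∀ x, m ≤ ∑ i, g i x) :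
    ∃ (w : Fin n → Vec d) (τ : Fin n → ℝ), ∑ i, w i = 0 ∧ ∑ i, τ i ≤ -m ∧
      ∀ i x, inner ℝ x (w i) - g i x ≤ τ i := by
  -- Each summand is translated independently. Since all `g i` are finite everywhere, every
  -- perturbation is admissible and no qualification is needed.
  let K : Set ((Fin n → Vec d) × ℝ) :=
    {p | ∃ x, ∑ i, g i (p.1 i + x) ≤ -p.2}
  have hK : Convex ℝ K := by
    rintro p ⟨x, hx⟩ q ⟨y, hy⟩ a b ha hb hab
    refine ⟨a • x + b • y, ?_⟩
    have h1 : ∑ i, g i ((a • p + b • q).1 i + (a • x + b • y))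
        ≤ ∑ i, (a * g i (p.1 i + x) + b * g i (q.1 i + y)) := by
      refine Finset.sum_le_sum fun i _ => ?_
      have := (hg i).2 (x := p.1 i + x) (y := q.1 i + y) trivial trivial ha hb hab
      refine le_trans (le_of_eq ?_) this
      congr 1
      simp only [Prod.fst_add, Prod.smul_fst, Pi.add_apply, Pi.smul_apply, smul_add]
      abel
    rw [Finset.sum_add_distrib, ← Finset.mul_sum, ← Finset.mul_sum] at h1
    simp only [Prod.snd_add, Prod.smul_snd, smul_eq_mul]
    nlinarith
  obtain ⟨φ, hφ⟩ := exists_linear_bound (v := -m) (r₀ := -∑ i, g i 0) hK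
    ⟨0, by simp⟩
    (by
      rintro r ⟨x, hx⟩
      have := hm x
      simp only [Pi.zero_apply, zero_add] at hx
      linarith)
    (fun p _ => ⟨1, one_pos, -∑ i, g i (-(p.1 i)), 0, by simp⟩)
  choose w hw using fun i => exists_inner_rep (φ ∘ₗ LinearMap.single ℝ (fun _ : Fin n => Vec d) i)
  have hrep : ∀ u : Fin n → Vec d, φ u = ∑ i, inner ℝ (u i) (w i) := by
    intro u
    conv_lhs => rw [← Finset.univ_sum_single u, map_sum]
    exact Finset.sum_congr rfl fun i _ => hw i (u i)
  have key : ∀ (y : Fin n → Vec d) (x : Vec d),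
      -∑ i, g i (y i) ≤ -m + ∑ i, inner ℝ (y i) (w i) - inner ℝ x (∑ i, w i) := by
    intro y x
    have := hφ (fun i => y i - x, -∑ i, g i (y i)) ⟨x, by simp⟩
    rw [hrep] at this
    simp only [inner_sub_left, Finset.sum_sub_distrib] at this
    rw [inner_sum]
    linarith
  have hsum : ∑ i, w i = 0 := by
    by_contra hne
    have hpos : 0 < inner ℝ (∑ i, w i) (∑ i, w i) := real_inner_self_pos.2 hne
    set N := inner ℝ (∑ i, w i) (∑ i, w i)
    set C := ∑ i, g i 0 - m
    -- `x` is a free common translation in `key`, so a nonzero `∑ i, w i` would make the right-hand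
    -- side arbitrarily small; the factor is chosen to miss by `1`.
    have := key 0 (((C + 1) / N) • ∑ i, w i)
    rw [real_inner_smul_left] at this
    have h2 : (C + 1) / N * N = C + 1 := by field_simp
    simp only [Pi.zero_apply, inner_zero_left, Finset.sum_const_zero] at this
    change _ ≤ -m + 0 - (C + 1) / N * N at this
    rw [h2] at this
    simp only [C] at this
    linarith
  obtain ⟨τ, hτ, hτ'⟩ := exists_sum_bound (h := fun i x => inner ℝ x (-(w i)) - g i x) (M := -m)
    (fun y => by
      have := key y 0
      simp only [inner_zero_left, inner_neg_right, Finset.sum_sub_distrib,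
        Finset.sum_neg_distrib] at this ⊢
      linarith)
  exact ⟨fun i => -(w i), τ, by simp [hsum], hτ', hτ⟩

/-- A real-valued convex function has a subgradient at every point. -/
theorem exists_subgradient {d : ℕ} {g : Vec d → ℝ} (hg : ConvexOn ℝ univ g) (x : Vec d) :
    ∃ w : Vec d, ∀ y, inner ℝ y w - g y ≤ inner ℝ x w - g x := by
  let K : Set (Vec d × ℝ) := {p | g (x + p.1) ≤ -p.2}
  have hK : Convex ℝ K := by
    intro p hp q hq a b ha hb hab
    have := hg.2 (x := x + p.1) (y := x + q.1) trivial trivial ha hb hab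
    have e : a • (x + p.1) + b • (x + q.1) = x + (a • p + b • q).1 := by
      obtain rfl : b = 1 - a := by linarith
      simp only [Prod.fst_add, Prod.smul_fst]
      module
    rw [e] at this
    change g _ ≤ -_
    change g _ ≤ -_ at hp
    change g _ ≤ -_ at hq
    simp only [Prod.snd_add, Prod.smul_snd, smul_eq_mul] at this ⊢
    nlinarith
  obtain ⟨φ, hφ⟩ := exists_linear_bound (v := -g x) (r₀ := -g x) hK
    (by simp [K]) (by intro r hr; simp [K] at hr; linarith)
    (fun p _ => ⟨1, one_pos, -g (x - p.1), by simp [K, sub_eq_add_neg]⟩)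
  obtain ⟨w, hw⟩ := exists_inner_rep φ
  refine ⟨-w, fun y => ?_⟩
  have := hφ (y - x, -g y) (by simp [K])
  rw [hw, inner_sub_left] at this
  simp only [inner_neg_right]
  simp only at this
  linarith

/-- Sion's minimax theorem with a compact set of maximizers and real values. -/
theorem exists_forall_le_of_minimax {E F : Type*}
    [TopologicalSpace E] [AddCommGroup E] [Module ℝ E] [IsTopologicalAddGroup E]
    [ContinuousSMul ℝ E] [TopologicalSpace F] [AddCommGroup F] [Module ℝ F]
    [IsTopologicalAddGroup F] [ContinuousSMul ℝ F]
    {Z : Set F} (hne : Z.Nonempty) (hZ : IsCompact Z) (hZc : Convex ℝ Z) {h : E → F → ℝ}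
    (hx : ∀ z, ConvexOn ℝ univ fun x => h x z) (hxc : ∀ z, Continuous fun x => h x z)
    (hz : ∀ x, ConcaveOn ℝ univ (h x)) (hzc : ∀ x, UpperSemicontinuous (h x))
    {m : ℝ} (hm : ∀ x, ∃ z ∈ Z, m ≤ h x z) : ∃ z ∈ Z, ∀ x, m ≤ h x z := by
  -- The sign flip puts the compact set on the minimizing side; extended values let the supremum
  -- over all of `E` exist without a bound.
  let f : F → E → EReal := fun z x => ((-h x z : ℝ) : EReal)
  have hlsc : ∀ x, LowerSemicontinuous fun z => f z x := fun x =>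
    continuous_coe_real_ereal.comp_lowerSemicontinuous
      (fun z y hy => (hzc x z (-y) (by linarith)).mono fun z' h' => by linarith)
      EReal.coe_strictMono.monotone
  have hmono : Monotone (fun r : ℝ => (r : EReal)) := EReal.coe_strictMono.monotone
  have key : (⨅ z ∈ Z, ⨆ x ∈ (univ : Set E), f z x) = ⨆ x ∈ (univ : Set E), ⨅ z ∈ Z, f z x :=
    Sion.minimax' hne hZc hZ (fun x _ => (hlsc x).lowerSemicontinuousOn Z)
      (fun x _ => by
        have := (((hz x).subset (subset_univ Z) hZc).neg).quasiconvexOn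
        exact this.monotone_comp (g := fun r : ℝ => (r : EReal)) hmono)
      convex_univ
      (fun z _ => ((continuous_coe_real_ereal.comp (hxc z).neg).upperSemicontinuous).upperSemicontinuousOn _)
      (fun z _ => by
        have := ((hx z).neg).quasiconcaveOn
        exact this.monotone_comp (g := fun r : ℝ => (r : EReal)) hmono)
  have h1 : (⨆ x ∈ (univ : Set E), ⨅ z ∈ Z, f z x) ≤ ((-m : ℝ) : EReal) := by
    refine iSup₂_le fun x _ => ?_
    obtain ⟨z, hz, hz'⟩ := hm x
    exact iInf₂_le_of_le z hz (EReal.coe_le_coe_iff.2 (by linarith))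
  have hl : LowerSemicontinuousOn (fun z => ⨆ x ∈ (univ : Set E), f z x) Z :=
    (lowerSemicontinuous_iSup fun x => lowerSemicontinuous_iSup fun _ => hlsc x).lowerSemicontinuousOn Z
  obtain ⟨z, hzZ, hzmin⟩ := hl.exists_isMinOn hne hZ
  refine ⟨z, hzZ, fun x => ?_⟩
  have h2 : (⨆ x ∈ (univ : Set E), f z x) ≤ ((-m : ℝ) : EReal) :=
    (le_iInf₂ fun z' hz' => hzmin hz').trans (key.le.trans h1)
  have h3 : f z x ≤ ((-m : ℝ) : EReal) := (le_iSup₂ (f := fun x _ => f z x) x trivial).trans h2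
  have := EReal.coe_le_coe_iff.1 h3
  linarith

/-- A convex set can be prolonged beyond points of its intrinsic interior. -/
theorem eventually_prolongation_mem {E : Type*} [AddCommGroup E] [Module ℝ E] [TopologicalSpace E]
    [IsTopologicalAddGroup E] [ContinuousSMul ℝ E] {S : Set E} {p q : E}
    (hp : p ∈ intrinsicInterior ℝ S) (hq : q ∈ S) :
    ∀ᶠ s in 𝓝 (0 : ℝ), p + s • (p - q) ∈ S := by
  obtain ⟨y, hy, rfl⟩ := mem_intrinsicInterior.1 hp
  have hqS : q ∈ affineSpan ℝ S := subset_affineSpan ℝ S hq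
  let γ : ℝ → affineSpan ℝ S := fun s =>
    ⟨(y : E) + s • ((y : E) - q), by
      have := AffineMap.lineMap_mem (-s) y.2 hqS
      rw [AffineMap.lineMap_apply_module'] at this
      convert this using 1
      rw [neg_smul, ← smul_neg, neg_sub, add_comm]⟩
  have hγ : Continuous γ := Continuous.subtype_mk (by fun_prop) _
  have h0 : γ 0 = y := Subtype.ext (by simp [γ])
  have hn : ∀ᶠ s in 𝓝 (0 : ℝ), γ s ∈ interior ((↑) ⁻¹' S : Set (affineSpan ℝ S)) :=
    hγ.continuousAt.eventually (by rw [h0]; exact isOpen_interior.mem_nhds hy)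
  exact hn.mono fun s hs => (interior_subset hs : γ s ∈ ((↑) ⁻¹' S : Set (affineSpan ℝ S)))

/-- Lagrange multipliers, up to a loss in value, for a convex program with a nonempty bounded
feasible region. -/
theorem exists_lagrange_multiplier_of_isBounded {d n : ℕ} {F₀ : Vec d → ℝ} {F : Fin n → Vec d → ℝ}
    (h₀ : ConvexOn ℝ univ F₀) (hF : ∀ i, ConvexOn ℝ univ (F i))
    (hne : {x | ∀ i, F i x ≤ 0}.Nonempty) (hbd : Bornology.IsBounded {x | ∀ i, F i x ≤ 0})
    {m t : ℝ} (hm : ∀ x, (∀ i, F i x ≤ 0) → m ≤ F₀ x) (ht : t < m) :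
    ∃ l : Fin n → ℝ, (∀ i, 0 ≤ l i) ∧ ∀ x, t ≤ F₀ x + ∑ i, l i * F i x := by
  have hc₀ : Continuous F₀ := continuousOn_univ.1 (h₀.continuousOn isOpen_univ)
  have hc : ∀ i, Continuous (F i) := fun i => continuousOn_univ.1 ((hF i).continuousOn isOpen_univ)
  obtain ⟨x₁, hx₁⟩ := hne
  obtain ⟨R, hR⟩ := hbd.subset_ball 0
  have hR' : ∀ x, (∀ i, F i x ≤ 0) → ‖x‖ < R := fun x hx => by simpa using hR hx
  -- `T` is compact and contains no feasible point, so the total violation `ψ` is at least some `δ >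
  -- 0` on it. Relaxing every constraint by `δ / (n + 1)` therefore still avoids `T`, and turns `x₁`
  -- into a Slater point.
  let T : Set (Vec d) := Metric.closedBall 0 R ∩ ({x | F₀ x ≤ t} ∪ {x | ‖x‖ = R})
  have hT : IsCompact T := (isCompact_closedBall _ _).inter_right
    ((isClosed_le hc₀ continuous_const).union (isClosed_eq continuous_norm continuous_const))
  let ψ : Vec d → ℝ := fun x => ∑ i, max (F i x) 0
  have hψ : Continuous ψ := by fun_prop
  obtain ⟨δ, hδ, hδT⟩ : ∃ δ, 0 < δ ∧ ∀ x ∈ T, δ ≤ ψ x := by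
    refine hT.exists_forall_le' hψ.continuousOn fun x hx => ?_
    by_contra hneg
    have hfeas : ∀ i, F i x ≤ 0 := fun i => by
      have h1 := Finset.single_le_sum (f := fun i => max (F i x) 0)
        (fun j _ => le_max_right _ _) (Finset.mem_univ i)
      exact (le_max_left _ _).trans (h1.trans (not_lt.1 hneg))
    rcases hx.2 with h | h
    · exact absurd (hm x hfeas) (not_le.2 (lt_of_le_of_lt h ht))
    · exact (hR' x hfeas).ne h
  have hε : 0 < δ / (n + 1) := by positivity
  have hnT : ∀ x, (∀ i, F i x ≤ δ / (n + 1)) → x ∉ T := fun x hx hxT => by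
    have h1 : ψ x ≤ ∑ _i : Fin n, δ / (n + 1) :=
      Finset.sum_le_sum fun i _ => max_le (hx i) hε.le
    rw [Finset.sum_const, Finset.card_univ, Fintype.card_fin, nsmul_eq_mul] at h1
    have h2 : (n : ℝ) * (δ / (n + 1)) < δ := by
      rw [mul_div_assoc', div_lt_iff₀ (by positivity)]
      nlinarith
    linarith [hδT x hxT]
  obtain ⟨l, hl, hl'⟩ := exists_lagrange_multiplier (F := fun i x => F i x - δ / (n + 1)) h₀
    (fun i => (hF i).sub (concaveOn_const _ convex_univ)) (x₀ := x₁)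
    (fun i => by linarith [show F i x₁ ≤ 0 from hx₁ i]) (m := t)
    (fun x hx => by
      have hx' : ∀ i, F i x ≤ δ / (n + 1) := fun i => by linarith [hx i]
      by_contra hlt
      rcases le_or_gt ‖x‖ R with hxR | hxR
      · exact hnT x hx' ⟨by simpa using hxR, Or.inl (not_le.1 hlt).le⟩
      -- A relaxed-feasible point outside the ball is joined to `x₁`; by convexity the crossing with
      -- the sphere is also relaxed-feasible, yet lies in `T`.
      · have hcont : Continuous fun s : ℝ => ‖(1 - s) • x₁ + s • x‖ := by fun_prop
        obtain ⟨s, hs, hsR⟩ := intermediate_value_Icc zero_le_one hcont.continuousOn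
          (show R ∈ Icc _ _ by simpa using ⟨(hR' x₁ hx₁).le, hxR.le⟩)
        refine hnT ((1 - s) • x₁ + s • x) (fun i => ?_) ⟨by simpa using hsR.le, Or.inr hsR⟩
        refine ((hF i).2 trivial trivial (sub_nonneg.2 hs.2) hs.1 (by ring)).trans ?_
        simp only [smul_eq_mul]
        nlinarith [hs.1, hs.2, hx' i, show F i x₁ ≤ 0 from hx₁ i])
  refine ⟨l, hl, fun x => (hl' x).trans ?_⟩
  gcongr with i
  · exact hl i
  · linarith

end RealConvex

/-! ### Conjugates and perspectives of real-valued functions -/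

section Conjugates

variable {d : ℕ} {g : Vec d → ℝ} {w : Vec d}

theorem conj_coe_le_iff {M : ℝ} :
    conj (fun x => (g x : EReal)) w ≤ M ↔ ∀ x, inner ℝ x w - g x ≤ M := by
  simp only [conj, iSup_le_iff]
  exact forall_congr' fun x => by norm_cast

/-- By Fenchel's inequality the biconjugate is at most `g`, which is finite. Hence the perspective
at `0` is the support function of the whole space. -/
theorem dom_conj_conj_coe : dom (conj (conj fun x => (g x : EReal))) = univ := by
  refine eq_univ_of_forall fun x => ?_
  refine lt_of_le_of_lt (b := (g x : EReal)) (iSup_le fun v => ?_) (EReal.coe_lt_top _)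
  have h : ((inner ℝ x v - g x : ℝ) : EReal) ≤ conj (fun x => (g x : EReal)) v := by
    rw [EReal.coe_sub]
    exact le_iSup (fun x => ((inner ℝ x v : ℝ) : EReal) - g x) x
  refine (EReal.sub_le_sub le_rfl h).trans ?_
  rw [real_inner_comm, ← EReal.coe_sub]
  exact EReal.coe_le_coe_iff.2 (by linarith)

/-- The perspective behaves as the conjugate of `t * g`, including at `t = 0`; this uniform
description spares all later arguments a case split on vanishing multipliers. -/
theorem perspective_conj_coe_le_iff {t M : ℝ} (ht : 0 ≤ t) :
    perspective (conj fun x => (g x : EReal)) w t ≤ M ↔ ∀ x, inner ℝ x w - t * g x ≤ M := by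
  rcases ht.eq_or_lt with rfl | ht
  · simp only [perspective, lt_irrefl, if_false, if_true, supportFun, dom_conj_conj_coe, mem_univ,
      iSup_pos, iSup_le_iff, zero_mul, sub_zero, EReal.coe_le_coe_iff]
  · rw [perspective, if_pos ht, mul_comm,
      ← EReal.le_div_iff_mul_le (by exact_mod_cast ht) (EReal.coe_ne_top t), ← EReal.coe_div,
      conj_coe_le_iff]
    refine forall_congr' fun x => ?_
    rw [le_div_iff₀ ht, inner_smul_right, sub_mul, mul_right_comm, inv_mul_cancel₀ ht.ne',
      one_mul, mul_comm (g x)]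

theorem conj_coe_ne_bot : conj (fun x => (g x : EReal)) w ≠ ⊥ := by
  intro h
  have := conj_coe_le_iff.1 (h ▸ bot_le : conj (fun x => (g x : EReal)) w ≤ (-g 0 - 1 : ℝ)) 0
  simp only [inner_zero_left] at this
  linarith

theorem perspective_conj_coe_ne_bot (t : ℝ) : perspective (conj fun x => (g x : EReal)) w t ≠ ⊥ := by
  rcases le_or_gt 0 t with ht | ht
  · intro h
    have := (perspective_conj_coe_le_iff ht).1
      (h ▸ bot_le : perspective (conj fun x => (g x : EReal)) w t ≤ (-(t * g 0) - 1 : ℝ)) 0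
    simp only [inner_zero_left] at this
    linarith
  · simp [perspective, not_lt.2 ht.le, ht.ne]

end Conjugates

/-! ### Sums of extended reals that avoid `-∞`. -/

section ERealSums

theorem ereal_sum_ne_bot {ι : Type*} (s : Finset ι) {b : ι → EReal} (hb : ∀ i, b i ≠ ⊥) :
    ∑ i ∈ s, b i ≠ ⊥ := by
  classical
  induction s using Finset.induction_on with
  | empty => simp
  | insert i s hi ih => rw [Finset.sum_insert hi]; exact EReal.add_ne_bot_iff.2 ⟨hb i, ih⟩

theorem ereal_ne_top_of_sum_ne_top {ι : Type*} {s : Finset ι} {b : ι → EReal}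
    (hb : ∀ i, b i ≠ ⊥) (h : ∑ i ∈ s, b i ≠ ⊤) {i : ι} (hi : i ∈ s) : b i ≠ ⊤ := by
  classical
  intro hi'
  rw [← Finset.add_sum_erase s b hi, hi'] at h
  exact h (EReal.top_add_of_ne_bot (ereal_sum_ne_bot _ hb))

theorem ereal_coe_sum {ι : Type*} (s : Finset ι) (τ : ι → ℝ) :
    ((∑ i ∈ s, τ i : ℝ) : EReal) = ∑ i ∈ s, (τ i : EReal) := by
  classical
  induction s using Finset.induction_on with
  | empty => simp
  | insert i s hi ih => rw [Finset.sum_insert hi, Finset.sum_insert hi, EReal.coe_add, ih]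

/-- Without `-∞` among the terms, a real lower bound forces every term to be finite, so it can be
certified by one real upper bound `τ` per term. -/
theorem coe_le_neg_sub_sum_iff {n : ℕ} {a : EReal} {b : Fin n → EReal} (ha : a ≠ ⊥)
    (hb : ∀ i, b i ≠ ⊥) {r : ℝ} :
    (r : EReal) ≤ -a - ∑ i, b i ↔
      ∃ τ : Fin (n + 1) → ℝ, r ≤ -∑ i, τ i ∧ a ≤ τ 0 ∧ ∀ i, b i ≤ τ (Fin.succ i) := by
  constructor
  · intro h
    have hne : -a - ∑ i, b i ≠ ⊥ := fun h' => by simp [h'] at h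
    have ha' : a ≠ ⊤ := by rintro rfl; simp at hne
    have hs : ∑ i, b i ≠ ⊤ := fun h' => by rw [h', EReal.sub_top] at hne; exact hne rfl
    have hb' := fun i => ereal_ne_top_of_sum_ne_top hb hs (Finset.mem_univ i)
    lift a to ℝ using ⟨ha', ha⟩
    lift b to Fin n → ℝ using fun i => ⟨hb' i, hb i⟩
    refine ⟨Fin.cons a b, ?_, by simp, fun i => by simp⟩
    rw [← ereal_coe_sum, ← EReal.coe_neg, ← EReal.coe_sub, EReal.coe_le_coe_iff] at h
    rw [Fin.sum_univ_succ]
    simp only [Fin.cons_zero, Fin.cons_succ]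
    linarith
  · rintro ⟨τ, hr, h0, hi⟩
    have h1 : ∑ i, b i ≤ ((∑ i : Fin n, τ i.succ : ℝ) : EReal) := by
      rw [ereal_coe_sum]
      exact Finset.sum_le_sum fun i _ => hi i
    refine le_trans ?_ (EReal.sub_le_sub (EReal.neg_le_neg_iff.2 h0) h1)
    rw [← EReal.coe_neg, ← EReal.coe_sub, EReal.coe_le_coe_iff]
    rw [Fin.sum_univ_succ] at hr
    linarith

end ERealSums

/-! ### The robust problem and its dual for real-valued saddle functions -/

section RealSaddle

variable {I L dx dz : ℕ}

/-- Multipliers with a leading `1` for the objective. -/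
def multipliers (l : Fin I → ℝ) : Fin (I + 1) → ℝ := Fin.cons 1 l

@[simp] theorem multipliers_zero (l : Fin I → ℝ) : multipliers l 0 = 1 := rfl

@[simp] theorem multipliers_succ (l : Fin I → ℝ) (i : Fin I) : multipliers l i.succ = l i := rfl

theorem multipliers_nonneg {l : Fin I → ℝ} (hl : ∀ i, 0 ≤ l i) (i : Fin (I + 1)) :
    0 ≤ multipliers l i := by
  refine Fin.cases ?_ (fun i => ?_) i
  · simp
  · simpa using hl i

variable {g : Fin (I + 1) → Vec dx → Vec dz → ℝ} {c : Fin L → Vec dz → EReal}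

/-- The interface to the dual objective: conjugates and perspectives disappear in favour of real
affine inequalities, with the objective treated as index `0` of multiplier `1`. -/
theorem coe_le_dualBest_obj_iff {w : Fin (I + 1) → Vec dx} {z : Fin (I + 1) → Vec dz}
    {l : Fin I → ℝ} (hl : ∀ i, 0 ≤ l i) {r : ℝ} :
    (r : EReal) ≤ (dualBest (fun i x z => (g i x z : EReal)) c).obj (w, z, l) ↔
      ∃ τ : Fin (I + 1) → ℝ, r ≤ -∑ i, τ i ∧
        ∀ i x, inner ℝ x (w i) - multipliers l i * g i x (z i) ≤ τ i := by
  refine (coe_le_neg_sub_sum_iff conj_coe_ne_bot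
    (fun i => perspective_conj_coe_ne_bot _)).trans ?_
  refine exists_congr fun τ => and_congr_right fun _ => ?_
  rw [Fin.forall_fin_succ]
  refine and_congr ?_ (forall_congr' fun i => ?_)
  · rw [conj_coe_le_iff]
    simp
  · rw [perspective_conj_coe_le_iff (hl i)]
    simp

theorem mem_dualBest_constraintSet_iff {f : Fin (I + 1) → Vec dx → Vec dz → EReal}
    {w : Fin (I + 1) → Vec dx} {z : Fin (I + 1) → Vec dz} {l : Fin I → ℝ} :
    (w, z, l) ∈ (dualBest f c).constraintSet ↔
      ∑ i, w i = 0 ∧ (∀ i, z i ∈ uncertaintySet c) ∧ ∀ i, 0 ≤ l i := by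
  have h1 : (∀ k, (((∑ i, w i) k : ℝ) : EReal) = 0) ↔ ∑ i, w i = 0 := by
    constructor
    · intro h
      ext k
      simpa using h k
    · intro h k
      rw [h]; simp
  have h2 : (∀ i, ((-l i : ℝ) : EReal) ≤ 0) ↔ ∀ i, 0 ≤ l i :=
    forall_congr' fun i => by norm_cast; simp
  rw [← h1, ← h2]
  simp only [Program.constraintSet, dualBest, mem_ofPred_eq, Sum.forall, Sum.elim_inl,
    Sum.elim_inr, Prod.forall, uncertaintySet]
  tauto

theorem worstCase_coe_le_iff {Z : Set (Vec dz)} {h : Vec dx → Vec dz → ℝ} {x : Vec dx} {M : EReal} :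
    worstCase Z (fun x z => (h x z : EReal)) x ≤ M ↔ ∀ z ∈ Z, (h x z : EReal) ≤ M := by
  simp only [worstCase, iSup_le_iff]

theorem mem_primalWorst_constraintSet_iff {f : Fin (I + 1) → Vec dx → Vec dz → EReal}
    {x : Vec dx} : x ∈ (primalWorst f c).constraintSet ↔
      ∀ i : Fin I, worstCase (uncertaintySet c) (f i.succ) x ≤ 0 := by
  simp [Program.constraintSet, primalWorst]

/-- Weak duality. -/
theorem dualBest_supremum_le_primalWorst_infimum :
    (dualBest (fun i x z => (g i x z : EReal)) c).supremum ≤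
      (primalWorst (fun i x z => (g i x z : EReal)) c).infimum := by
  refine iSup₂_le fun y hy => le_iInf₂ fun x hx => ?_
  obtain ⟨w, z, l⟩ := y
  obtain ⟨hw, hz, hl⟩ := mem_dualBest_constraintSet_iff.1 hy
  rw [mem_primalWorst_constraintSet_iff] at hx
  by_contra hlt
  obtain ⟨r, h1, h2⟩ := EReal.lt_iff_exists_real_btwn.1 (not_le.1 hlt)
  obtain ⟨τ, hr, hτ⟩ := (coe_le_dualBest_obj_iff hl).1 h2.le
  have h3 : g 0 x (z 0) < r := by
    have := (worstCase_coe_le_iff.1 (le_refl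
      ((primalWorst (fun i x z => (g i x z : EReal)) c).obj x)) (z 0) (hz 0)).trans_lt h1
    exact_mod_cast this
  have h4 : ∀ i : Fin I, l i * g i.succ x (z i.succ) ≤ 0 := fun i => by
    have := worstCase_coe_le_iff.1 (hx i) (z i.succ) (hz _)
    exact mul_nonpos_of_nonneg_of_nonpos (hl i) (by exact_mod_cast this)
  -- On summation the linear terms cancel, because `∑ i, w i = 0`.
  have h5 := Finset.sum_le_sum fun i (_ : i ∈ Finset.univ) => hτ i x
  rw [Finset.sum_sub_distrib, ← inner_sum, hw, inner_zero_right, Fin.sum_univ_succ] at h5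
  have h6 := Finset.sum_nonpos fun i (_ : i ∈ Finset.univ) => h4 i
  simp only [multipliers_zero, multipliers_succ] at h5
  linarith

theorem convex_uncertaintySet (hc : ∀ l, IsPCC (c l)) : Convex ℝ (uncertaintySet c) := by
  intro y hy z hz a b ha hb hab l
  have := (hc l).2.2 (x := (y, 0)) (y := (z, 0)) (by simpa using hy l) (by simpa using hz l)
    ha hb hab
  simpa using this

theorem isClosed_uncertaintySet (hc : ∀ l, IsPCC (c l)) : IsClosed (uncertaintySet c) := by
  have : uncertaintySet c = ⋂ l, c l ⁻¹' Iic 0 := by ext; simp [uncertaintySet]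
  rw [this]
  exact isClosed_iInter fun l => (hc l).2.1.1.isClosed_preimage 0

/-- A saddle function all of whose partial functions are proper is real-valued. -/
theorem exists_real_saddle {f : Fin (I + 1) → Vec dx → Vec dz → EReal}
    (hf_x : ∀ i z, IsPCC (fun x => f i x z)) (hf_z : ∀ i x, IsPCC (fun z => - f i x z)) :
    ∃ g : Fin (I + 1) → Vec dx → Vec dz → ℝ, (f = fun i x z => (g i x z : EReal)) ∧
      (∀ i z, ConvexOn ℝ univ fun x => g i x z) ∧ (∀ i x, ConcaveOn ℝ univ (g i x)) ∧
      ∀ i x, UpperSemicontinuous (g i x) := by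
  have hbot : ∀ i x z, f i x z ≠ ⊥ := fun i x z => ((hf_x i z).1.1 x).ne'
  have htop : ∀ i x z, f i x z ≠ ⊤ := fun i x z h => by
    have := (hf_z i x).1.1 z
    simp [h] at this
  have hg : f = fun i x z => ((f i x z).toReal : EReal) := by
    funext i x z
    exact (EReal.coe_toReal (htop i x z) (hbot i x z)).symm
  generalize hg' : (fun i x z => (f i x z).toReal) = g at hg
  have hfg : f = fun i x z => (g i x z : EReal) := by rw [← hg']; exact hg
  subst hfg
  refine ⟨g, rfl, fun i z => ⟨convex_univ, ?_⟩, fun i x => ⟨convex_univ, ?_⟩, ?_⟩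
  · intro x _ y _ a b ha hb hab
    have := (hf_x i z).2.2 (x := (x, g i x z)) (y := (y, g i y z)) (by simp) (by simp) ha hb hab
    simpa using this
  · intro x' _ y _ a b ha hb hab
    have := (hf_z i x).2.2 (x := (x', -g i x x')) (y := (y, -g i x y)) (by simp) (by simp)
      ha hb hab
    simp only [Prod.smul_mk, Prod.mk_add_mk, mem_ofPred_eq, smul_eq_mul, ← EReal.coe_neg,
      EReal.coe_le_coe_iff] at this
    simp only [smul_eq_mul]
    linarith
  · intro i x z a ha
    have hlt : ∀ z', ((-a : ℝ) : EReal) < -(g i x z' : EReal) ↔ g i x z' < a := fun z' => by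
      rw [← EReal.coe_neg, EReal.coe_lt_coe_iff, neg_lt_neg_iff]
    exact ((hf_z i x).2.1.1 z ((-a : ℝ) : EReal) ((hlt z).2 ha)).mono fun z' h => (hlt z').1 h

/-- Over a nonempty compact set, the worst case of a real-valued saddle function is a real-valued
convex function and is attained. -/
theorem exists_real_worstCase {Z : Set (Vec dz)} (hne : Z.Nonempty) (hZ : IsCompact Z)
    {h : Vec dx → Vec dz → ℝ} (hx : ∀ z, ConvexOn ℝ univ fun x => h x z)
    (hz : ∀ x, UpperSemicontinuous (h x)) :
    ∃ F : Vec dx → ℝ, (worstCase Z (fun x z => (h x z : EReal)) = fun x => (F x : EReal)) ∧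
      ConvexOn ℝ univ F ∧ ∀ x, ∃ z ∈ Z, F x = h x z := by
  have hmax : ∀ x, ∃ z ∈ Z, IsMaxOn (h x) Z z := fun x =>
    ((hz x).upperSemicontinuousOn Z).exists_isMaxOn hne hZ
  choose ζ hζ hmax using hmax
  refine ⟨fun x => h x (ζ x), ?_, ⟨convex_univ, ?_⟩, fun x => ⟨ζ x, hζ x, rfl⟩⟩
  · funext x
    refine le_antisymm (worstCase_coe_le_iff.2 fun z hz => ?_)
      (worstCase_coe_le_iff.1 le_rfl _ (hζ x))
    exact EReal.coe_le_coe_iff.2 (hmax x hz)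
  · intro x _ y _ a b ha hb hab
    -- Convexity is used at the scenario that is worst for the convex combination; it is no worse
    -- than the maximizers at `x` and `y`.
    refine ((hx _).2 trivial trivial ha hb hab).trans ?_
    exact add_le_add (mul_le_mul_of_nonneg_left (hmax x (hζ _)) ha)
      (mul_le_mul_of_nonneg_left (hmax y (hζ _)) hb)

/-- Nonnegative Lagrange multipliers of the worst-case problem can be completed to a feasible point
of the dual best problem that is at least as good. -/
theorem exists_dualBest_of_multipliers (hgx : ∀ i z, ConvexOn ℝ univ fun x => g i x z)
    (hgz : ∀ i x, ConcaveOn ℝ univ (g i x)) (hgc : ∀ i x, UpperSemicontinuous (g i x))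
    (hc : ∀ l, IsPCC (c l)) (hne : (uncertaintySet c).Nonempty)
    (hZ : IsCompact (uncertaintySet c)) {F : Fin (I + 1) → Vec dx → ℝ}
    (hF : ∀ i x, ∃ z ∈ uncertaintySet c, F i x = g i x z)
    {l : Fin I → ℝ} (hl : ∀ i, 0 ≤ l i) {m : ℝ}
    (hm : ∀ x, m ≤ F 0 x + ∑ i : Fin I, l i * F i.succ x) :
    ∃ y ∈ (dualBest (fun i x z => (g i x z : EReal)) c).constraintSet,
      (m : EReal) ≤ (dualBest (fun i x z => (g i x z : EReal)) c).obj y := by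
  have hμ := multipliers_nonneg hl
  let Z' : Set (Fin (I + 1) → Vec dz) := Set.pi univ fun _ => uncertaintySet c
  -- The Lagrangian with one independent scenario per function. It is convex in `x` and concave in
  -- the tuple, and its maximum over the compact product is the Lagrangian of the worst cases.
  let h : Vec dx → (Fin (I + 1) → Vec dz) → ℝ := fun x z => ∑ i, multipliers l i * g i x (z i)
  have hgμ : ∀ i z, ConvexOn ℝ univ fun x => multipliers l i * g i x z := fun i z =>
    (hgx i z).smul (hμ i)
  have hx : ∀ z, ConvexOn ℝ univ fun x => h x z := fun z => by
    refine ⟨convex_univ, fun x _ y _ a b ha hb hab => ?_⟩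
    simp only [h, Finset.smul_sum, ← Finset.sum_add_distrib]
    exact Finset.sum_le_sum fun i _ => (hgμ i (z i)).2 trivial trivial ha hb hab
  obtain ⟨z, hz, hzm⟩ := exists_forall_le_of_minimax (Z := Z') (h := h) (m := m)
    (univ_pi_nonempty_iff.2 fun _ => hne) (isCompact_univ_pi fun _ => hZ)
    (convex_pi fun _ _ => convex_uncertaintySet hc) hx
    (fun z => continuousOn_univ.1 ((hx z).continuousOn isOpen_univ))
    (fun x => by
      refine ⟨convex_univ, fun y _ z _ a b ha hb hab => ?_⟩
      simp only [h, Finset.smul_sum, ← Finset.sum_add_distrib]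
      exact Finset.sum_le_sum fun i _ =>
        ((hgz i x).smul (hμ i)).2 (x := y i) (y := z i) trivial trivial ha hb hab)
    (fun x => by
      refine upperSemicontinuous_sum fun i _ => ?_
      exact Continuous.comp_upperSemicontinuous (g := fun r : ℝ => multipliers l i * r)
        (by fun_prop) ((hgc i x).comp (continuous_apply i))
        (monotone_mul_left_of_nonneg (hμ i)))
    (fun x => by
      choose ζ hζ hζ' using fun i => hF i x
      refine ⟨ζ, fun i _ => hζ i, (hm x).trans (le_of_eq ?_)⟩
      simp only [h, Fin.sum_univ_succ, multipliers_zero, multipliers_succ, hζ', one_mul])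
  obtain ⟨w, τ, hw, hτ, hwτ⟩ := exists_fenchel (fun i => hgμ i (z i)) hzm
  refine ⟨(w, z, l), mem_dualBest_constraintSet_iff.2 ⟨hw, fun i => hz i trivial, hl⟩, ?_⟩
  exact (coe_le_dualBest_obj_iff hl).2 ⟨τ, by linarith, hwτ⟩

end RealSaddle

/-! ### Strict Slater points of the dual. -/

section Slater

variable {I L dx dz : ℕ} {g : Fin (I + 1) → Vec dx → Vec dz → ℝ} {c : Fin L → Vec dz → EReal}

/-- A convex function that is negative at `a` and finite further along a ray stays nonpositive on
an initial segment of that ray. -/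
theorem IsPCC.eventually_nonpos {d : ℕ} {h : Vec d → EReal} (hh : IsPCC h) {a v : Vec d}
    (ha : h a < 0) (hv : ∀ᶠ s in 𝓝 (0 : ℝ), h (a + s • v) < ⊤) :
    ∀ᶠ s in 𝓝[≥] (0 : ℝ), h (a + s • v) ≤ 0 := by
  obtain ⟨s₀, hs₀, hs₀'⟩ := ((hv.filter_mono nhdsWithin_le_nhds).and
    (self_mem_nhdsWithin (a := (0 : ℝ)) (s := Ioi 0))).exists
  replace hs₀' : 0 < s₀ := hs₀'
  obtain ⟨α, hα⟩ : ∃ α : ℝ, h a = α :=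
    ⟨_, (EReal.coe_toReal (ha.trans EReal.zero_lt_top).ne (hh.1.1 a).ne').symm⟩
  obtain ⟨β, hβ⟩ : ∃ β : ℝ, h (a + s₀ • v) = β :=
    ⟨_, (EReal.coe_toReal hs₀.ne (hh.1.1 _).ne').symm⟩
  have hα0 : α < 0 := by rw [hα] at ha; exact_mod_cast ha
  have hden : 0 < |β| - α := by linarith [abs_nonneg β]
  -- At fraction `θ` of the way to `s₀`, convexity bounds `h` by `α + θ * (|β| - α)`, nonpositive
  -- for `θ` up to this ratio. The absolute value keeps the ratio positive and at most `1`.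
  have h3 : 0 < s₀ * (-α / (|β| - α)) := mul_pos hs₀' (div_pos (by linarith) hden)
  refine mem_of_superset (Icc_mem_nhdsGE h3) fun s hs => ?_
  have hθ : s / s₀ ≤ -α / (|β| - α) := by rw [div_le_iff₀ hs₀', mul_comm]; exact hs.2
  have hθ0 : 0 ≤ s / s₀ := div_nonneg hs.1 hs₀'.le
  have hθm : s / s₀ * (|β| - α) ≤ -α := (le_div_iff₀ hden).1 hθ
  have hθ1 : s / s₀ ≤ 1 := hθ.trans ((div_le_one hden).2 (by linarith [abs_nonneg β]))
  have key := hh.2.2 (x := (a, α)) (y := (a + s₀ • v, β)) (by simp [hα]) (by simp [hβ])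
    (sub_nonneg.2 hθ1) hθ0 (by ring)
  have e : (1 - s / s₀) • a + (s / s₀) • (a + s₀ • v) = a + s • v := by
    rw [smul_add, smul_smul, div_mul_cancel₀ _ hs₀'.ne', sub_smul, one_smul]
    abel
  simp only [Prod.smul_mk, Prod.mk_add_mk, mem_ofPred_eq, smul_eq_mul, e] at key
  refine key.trans ?_
  rw [← EReal.coe_zero, EReal.coe_le_coe_iff]
  nlinarith [le_abs_self β]

/-- The epigraph of `w ↦ inf_{z ∈ Z} h^{*1}(w, z)`. -/
def conjEpi (Z : Set (Vec dz)) (h : Vec dx → Vec dz → ℝ) : Set (Vec dx × ℝ) :=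
  {p | ∃ z ∈ Z, ∀ x, inner ℝ x p.1 - h x z ≤ p.2}

theorem convex_conjEpi {Z : Set (Vec dz)} (hZ : Convex ℝ Z) {h : Vec dx → Vec dz → ℝ}
    (hz : ∀ x, ConcaveOn ℝ univ (h x)) : Convex ℝ (conjEpi Z h) := by
  rintro p ⟨y, hy, hyp⟩ q ⟨z, hz', hzq⟩ a b ha hb hab
  refine ⟨a • y + b • z, hZ hy hz' ha hb hab, fun x => ?_⟩
  have h1 := (hz x).2 (x := y) (y := z) trivial trivial ha hb hab
  simp only [smul_eq_mul] at h1
  simp only [Prod.fst_add, Prod.smul_fst, Prod.snd_add, Prod.smul_snd, smul_eq_mul,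
    inner_add_right, inner_smul_right]
  nlinarith [mul_le_mul_of_nonneg_left (hyp x) ha, mul_le_mul_of_nonneg_left (hzq x) hb]

/-- The values `∑ w_i` of the dual equality constraint, paired with the dual objective values. -/
def dualImage (Z : Set (Vec dz)) (g : Fin (I + 1) → Vec dx → Vec dz → ℝ) : Set (Vec dx × ℝ) :=
  {q | ∃ l : Fin I → ℝ, (∀ i, 0 ≤ l i) ∧ ∃ p : Fin (I + 1) → Vec dx × ℝ,
    (∀ i, p i ∈ conjEpi Z (g i)) ∧ q.1 = ∑ i, multipliers l i • (p i).1 ∧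
      q.2 = -∑ i, multipliers l i * (p i).2}

/-- The products of multipliers and epigraph points are harmless: for a convex set `C` and
nonnegative `a`, `b`, one has `a • C + b • C = (a + b) • C`, so each index combines with weights
proportional to its multipliers. -/
theorem convex_dualImage {Z : Set (Vec dz)} (hZ : Convex ℝ Z)
    (hgz : ∀ i x, ConcaveOn ℝ univ (g i x)) : Convex ℝ (dualImage Z g) := by
  rintro q ⟨l, hl, p, hp, hq1, hq2⟩ q' ⟨l', hl', p', hp', hq1', hq2'⟩ a b ha hb hab
  have hk : ∀ i, ∃ k ∈ conjEpi Z (g i), (a * multipliers l i) • p i + (b * multipliers l' i) • p' i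
      = (a * multipliers l i + b * multipliers l' i) • k := by
    intro i
    have h : (a * multipliers l i) • p i + (b * multipliers l' i) • p' i
        ∈ (a * multipliers l i + b * multipliers l' i) • conjEpi Z (g i) := by
      rw [(convex_conjEpi hZ (hgz i)).add_smul (mul_nonneg ha (multipliers_nonneg hl i))
        (mul_nonneg hb (multipliers_nonneg hl' i))]
      exact add_mem_add (smul_mem_smul_set (hp i)) (smul_mem_smul_set (hp' i))
    obtain ⟨k, hk, e⟩ := h
    exact ⟨k, hk, e.symm⟩
  choose k hk hke using hk
  have hμ : ∀ i, multipliers (a • l + b • l') i = a * multipliers l i + b * multipliers l' i := by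
    intro i
    refine Fin.cases ?_ (fun i => ?_) i
    · simp [hab]
    · simp
  refine ⟨a • l + b • l', fun i => add_nonneg (mul_nonneg ha (hl i)) (mul_nonneg hb (hl' i)),
    k, hk, ?_, ?_⟩
  · simp only [Prod.fst_add, Prod.smul_fst, hq1, hq1', Finset.smul_sum, ← Finset.sum_add_distrib,
      smul_smul]
    refine Finset.sum_congr rfl fun i _ => ?_
    rw [hμ]
    exact congrArg Prod.fst (hke i)
  · simp only [Prod.snd_add, Prod.smul_snd, hq2, hq2', smul_eq_mul, mul_neg, Finset.mul_sum,
      ← neg_add, ← Finset.sum_add_distrib, ← mul_assoc]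
    congr 1
    refine Finset.sum_congr rfl fun i _ => ?_
    rw [hμ]
    exact congrArg Prod.snd (hke i)

/-- At a strict Slater point of the dual best problem, the scaled variables `w_i / λ_i` can be
prolonged away from any point of the effective domain. -/
theorem eventually_mem_conjEpi_of_slater (hc : ∀ l, IsPCC (c l))
    {w : Fin (I + 1) → Vec dx} {z : Fin (I + 1) → Vec dz} {l : Fin I → ℝ}
    (hS : (dualBest (fun i x z => (g i x z : EReal)) c).IsMaxStrictSlater (w, z, l))
    (hl : ∀ i, 0 < multipliers l i)
    {p : Fin (I + 1) → Vec dx × ℝ} (hp : ∀ i, p i ∈ conjEpi (uncertaintySet c) (g i))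
    (i : Fin (I + 1)) :
    ∀ᶠ s in 𝓝[≥] (0 : ℝ), ∃ ρ, ((multipliers l i)⁻¹ • w i + s • ((multipliers l i)⁻¹ • w i - (p i).1),
      ρ) ∈ conjEpi (uncertaintySet c) (g i) := by
  obtain ⟨⟨hdom, -, -, hneg⟩, hobj⟩ := hS
  choose ζ hζ hζp using hp
  have hl0 : ∀ i, 0 ≤ l i := fun i => (hl i.succ).le
  -- A comparison point with the same multipliers as the Slater point: prolonging away from it moves
  -- only `w` and `z`, and dividing by `multipliers l i` gives the wanted point.
  let q : DualVar I dx dz := (fun i => multipliers l i • (p i).1, ζ, l)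
  have hdomobj : ∀ y, y ∈ dom (fun y => -(dualBest (fun i x z => (g i x z : EReal)) c).obj y) ↔
      ∃ r : ℝ, (r : EReal) ≤ (dualBest (fun i x z => (g i x z : EReal)) c).obj y := by
    intro y
    have : y ∈ dom (fun y => -(dualBest (fun i x z => (g i x z : EReal)) c).obj y) ↔
      ⊥ < (dualBest (fun i x z => (g i x z : EReal)) c).obj y := by
      rw [← EReal.neg_lt_neg_iff, EReal.neg_bot]; rfl
    rw [this]
    constructor
    · intro h
      obtain ⟨r, -, h⟩ := EReal.lt_iff_exists_real_btwn.1 h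
      exact ⟨r, h.le⟩
    · rintro ⟨r, hr⟩
      exact (EReal.bot_lt_coe r).trans_le hr
  have hq : q ∈ dom (fun y => -(dualBest (fun i x z => (g i x z : EReal)) c).obj y) := by
    refine (hdomobj q).2 ⟨_, (coe_le_dualBest_obj_iff hl0).2
      ⟨fun i => multipliers l i * (p i).2, le_rfl, fun i x => ?_⟩⟩
    rw [inner_smul_right, ← mul_sub]
    exact mul_le_mul_of_nonneg_left (hζp i x) (hl i).le
  have hZ : ∀ᶠ s in 𝓝[≥] (0 : ℝ), ∀ k, c k (z i + s • (z i - ζ i)) ≤ 0 := by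
    refine eventually_all.2 fun k => ?_
    refine (hc k).eventually_nonpos (hneg (Sum.inr (i, k))) ?_
    have hq' : q ∈ dom ((dualBest (fun i x z => (g i x z : EReal)) c).ineq (Sum.inr (i, k))) :=
      (hζ i k).trans_lt EReal.zero_lt_top
    have h := eventually_prolongation_mem (hdom (Sum.inr (i, k))) hq'
    filter_upwards [h] with s hs
    exact hs
  filter_upwards [hZ, (eventually_prolongation_mem hobj hq).filter_mono nhdsWithin_le_nhds]
    with s hsZ hs
  obtain ⟨r, hr⟩ := (hdomobj _).1 hs
  have e : (w, z, l) + s • ((w, z, l) - q) = (w + s • (w - q.1), z + s • (z - ζ), l) := by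
    simp [q]
  rw [e] at hr
  obtain ⟨τ, -, hτ⟩ := (coe_le_dualBest_obj_iff hl0).1 hr
  refine ⟨τ i / multipliers l i, _, hsZ, fun x => ?_⟩
  rw [le_div_iff₀ (hl i)]
  refine le_trans (le_of_eq ?_) (hτ i x)
  simp only [q, Pi.add_apply, Pi.smul_apply, Pi.sub_apply, inner_add_right, inner_sub_right,
    inner_smul_right]
  have := (hl i).ne'
  field_simp

/-- A strict Slater point of the dual best problem with bounded objective yields an optimal solution
of the primal worst problem. -/
theorem exists_primalWorst_of_slater (hgx : ∀ i z, ConvexOn ℝ univ fun x => g i x z)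
    (hgz : ∀ i x, ConcaveOn ℝ univ (g i x)) (hc : ∀ l, IsPCC (c l))
    (hne : (uncertaintySet c).Nonempty)
    {w : Fin (I + 1) → Vec dx} {z : Fin (I + 1) → Vec dz} {l : Fin I → ℝ}
    (hS : (dualBest (fun i x z => (g i x z : EReal)) c).IsMaxStrictSlater (w, z, l))
    {v : ℝ} (hv : (dualBest (fun i x z => (g i x z : EReal)) c).supremum ≤ v) :
    ∃ x, (∀ z ∈ uncertaintySet c, g 0 x z ≤ v) ∧
      ∀ i : Fin I, ∀ z ∈ uncertaintySet c, g i.succ x z ≤ 0 := by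
  have hlpos : ∀ i, 0 < multipliers l i := by
    intro i
    refine Fin.cases ?_ (fun i => ?_) i
    · simp
    · have := hS.1.2.2.2 (Sum.inl i)
      change ((-l i : ℝ) : EReal) < 0 at this
      rw [← EReal.coe_zero, EReal.coe_lt_coe_iff] at this
      simpa using this
  obtain ⟨hw, -, -⟩ := mem_dualBest_constraintSet_iff.1 hS.1.2.2.1
  have hsub : ∀ i x, ∀ z ∈ uncertaintySet c, ∃ u,
      (u, inner ℝ x u - g i x z) ∈ conjEpi (uncertaintySet c) (g i) := fun i x z hz => by
    obtain ⟨u, hu⟩ := exists_subgradient (hgx i z) x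
    exact ⟨u, z, hz, hu⟩
  obtain ⟨ζ₀, hζ₀⟩ := hne
  have hp₀ : ∃ p : Fin (I + 1) → Vec dx × ℝ, ∀ i, p i ∈ conjEpi (uncertaintySet c) (g i) := by
    choose u hu using fun i => hsub i 0 ζ₀ hζ₀
    exact ⟨_, hu⟩
  have h₀ : ∃ r₀, ((0 : Vec dx), r₀) ∈ dualImage (uncertaintySet c) g := by
    obtain ⟨p, hp⟩ := hp₀
    -- Only the parameter `s = 0` is used: the Slater point itself has residual `∑ i, w i = 0`.
    choose ρ hρ using fun i =>
      (eventually_mem_conjEpi_of_slater hc hS hlpos hp i).self_of_nhdsWithin self_mem_Ici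
    refine ⟨_, l, fun i => (hlpos i.succ).le, _, hρ, ?_, rfl⟩
    simp only [zero_smul, add_zero, smul_smul, mul_inv_cancel₀ (hlpos _).ne', one_smul, hw]
  obtain ⟨r₀, h₀⟩ := h₀
  obtain ⟨φ, hφ⟩ := exists_linear_bound (v := v)
    (convex_dualImage (convex_uncertaintySet hc) hgz) h₀
    (by
      rintro r ⟨k, hk, p, hp, h1, h2⟩
      choose ζ hζ hζp using hp
      have hmem : ((fun i => multipliers k i • (p i).1, ζ, k) : DualVar I dx dz) ∈
          (dualBest (fun i x z => (g i x z : EReal)) c).constraintSet :=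
        mem_dualBest_constraintSet_iff.2 ⟨h1.symm, hζ, hk⟩
      have hr : (r : EReal) ≤ (dualBest (fun i x z => (g i x z : EReal)) c).obj
          (fun i => multipliers k i • (p i).1, ζ, k) := by
        refine (coe_le_dualBest_obj_iff hk).2
          ⟨fun i => multipliers k i * (p i).2, h2.le, fun i x => ?_⟩
        rw [inner_smul_right, ← mul_sub]
        exact mul_le_mul_of_nonneg_left (hζp i x) (multipliers_nonneg hk i)
      exact EReal.coe_le_coe_iff.1 (hr.trans ((le_iSup₂ (f := fun y _ =>
        (dualBest (fun i x z => (g i x z : EReal)) c).obj y) _ hmem).trans hv)))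
    (by
      rintro q ⟨k, hk, p, hp, h1, -⟩
      -- Prolong the multipliers from `k` through `l`. With step `s = t * k_i / ν_i` for the scaled
      -- variables, the identity `ν_i + t * k_i = (1 + t) * l_i` gives `(1 + t) • w i - t • k_i • (p
      -- i).1`; as `∑ i, w i = 0`, these sum to `-(t • q.1)`.
      let ν : Fin (I + 1) → ℝ → ℝ := fun i t =>
        multipliers l i + t * (multipliers l i - multipliers k i)
      have hν : ∀ i, Tendsto (ν i) (𝓝[>] 0) (𝓝 (multipliers l i)) := fun i => by
        have : Continuous (ν i) := by fun_prop
        simpa [ν] using (this.tendsto 0).mono_left (nhdsWithin_le_nhds (s := Ioi 0))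
      have hνpos : ∀ i, ∀ᶠ t in 𝓝[>] (0 : ℝ), 0 < ν i t := fun i =>
        (hν i).eventually (lt_mem_nhds (hlpos i))
      have hs : ∀ i, Tendsto (fun t => t * multipliers k i / ν i t) (𝓝[>] 0) (𝓝[≥] 0) := fun i => by
        refine tendsto_nhdsWithin_iff.2 ⟨?_, ?_⟩
        · have h1 : Tendsto (fun t : ℝ => t * multipliers k i) (𝓝[>] 0) (𝓝 0) := by
            have : Continuous fun t : ℝ => t * multipliers k i := by fun_prop
            simpa using (this.tendsto 0).mono_left (nhdsWithin_le_nhds (s := Ioi 0))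
          have h2 := h1.div (hν i) (hlpos i).ne'
          rwa [zero_div] at h2
        · filter_upwards [hνpos i, self_mem_nhdsWithin] with t ht ht'
          exact div_nonneg (mul_nonneg (le_of_lt ht') (multipliers_nonneg hk i)) ht.le
      obtain ⟨t, ⟨hνt, hst⟩, ht⟩ := (((eventually_all.2 hνpos).and (eventually_all.2 fun i =>
        (hs i).eventually (eventually_mem_conjEpi_of_slater hc hS hlpos hp i))).and
          self_mem_nhdsWithin).exists
      choose ρ hρ using hst
      have hμ : ∀ i, multipliers (l + t • (l - k)) i = ν i t := by
        intro i
        refine Fin.cases ?_ (fun i => ?_) i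
        · simp [ν]
        · simp [ν]
      refine ⟨t, ht, _, l + t • (l - k), fun i => ?_, _, hρ, ?_, rfl⟩
      · have := (hνt i.succ).le
        rwa [← hμ, multipliers_succ] at this
      · have hterm : ∀ i, multipliers (l + t • (l - k)) i • ((multipliers l i)⁻¹ • w i +
            (t * multipliers k i / ν i t) • ((multipliers l i)⁻¹ • w i - (p i).1)) =
            (1 + t) • w i - t • multipliers k i • (p i).1 := fun i => by
          have h1 := (hνt i).ne'
          have h2 := (hlpos i).ne'
          rw [hμ, smul_add, smul_smul, smul_smul, smul_sub, smul_smul, smul_smul,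
            mul_div_cancel₀ _ h1, ← add_sub_assoc, ← add_smul]
          congr 2
          simp only [ν]
          field_simp
          ring
        simp only [hterm]
        rw [Finset.sum_sub_distrib, ← Finset.smul_sum, hw, smul_zero, zero_sub, h1,
          Finset.smul_sum])
  obtain ⟨x, hx⟩ := exists_inner_rep φ
  have key : ∀ k : Fin I → ℝ, (∀ i, 0 ≤ k i) → ∀ ζ : Fin (I + 1) → Vec dz,
      (∀ i, ζ i ∈ uncertaintySet c) → ∑ i, multipliers k i * g i (-x) (ζ i) ≤ v := by
    intro k hk ζ hζ
    -- For subgradients at `-x` the Fenchel–Young inequality is an equality, so the bound `hφ` on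
    -- the dual image becomes a bound on the Lagrangian at `-x`.
    choose u hu using fun i => hsub i (-x) (ζ i) (hζ i)
    have h := hφ (∑ i, multipliers k i • u i,
      -∑ i, multipliers k i * (inner ℝ (-x) (u i) - g i (-x) (ζ i))) ⟨k, hk, _, hu, rfl, rfl⟩
    rw [hx] at h
    simp only [sum_inner, inner_smul_left, inner_neg_left, mul_sub, Finset.sum_sub_distrib,
      mul_neg, Finset.sum_neg_distrib] at h
    simp only [real_inner_comm, conj_trivial] at h
    linarith
  have h0 : ∀ z ∈ uncertaintySet c, g 0 (-x) z ≤ v := fun z hz => by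
    simpa [Fin.sum_univ_succ] using key 0 (fun _ => le_rfl) (fun _ => z) fun _ => hz
  refine ⟨-x, h0, fun i z hz => ?_⟩
  by_contra hpos
  rw [not_le] at hpos
  -- The Lagrangian bound holds for all multipliers, so a violated constraint is refuted by a large
  -- enough single multiplier.
  have hkey : ∀ t : ℝ, 0 ≤ t → g 0 (-x) z + t * g i.succ (-x) z ≤ v := fun t ht => by
    have := key (Pi.single i t) (fun j => by by_cases h : j = i <;> simp [h, ht])
      (fun _ => z) fun _ => hz
    simpa [Fin.sum_univ_succ, Pi.single_apply] using this
  have h1 := hkey ((v - g 0 (-x) z + 1) / g i.succ (-x) z)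
    (div_nonneg (by linarith [h0 z hz]) hpos.le)
  rw [div_mul_cancel₀ _ hpos.ne'] at h1
  linarith

end Slater

/-! ### The three strong duality statements. -/

section StrongDuality

variable {I L dx dz : ℕ} {g : Fin (I + 1) → Vec dx → Vec dz → ℝ} {c : Fin L → Vec dz → EReal}

/-- Over a compact uncertainty set, the primal worst problem is a convex program with real-valued
data. -/
theorem exists_real_primalWorst (hgx : ∀ i z, ConvexOn ℝ univ fun x => g i x z)
    (hgc : ∀ i x, UpperSemicontinuous (g i x)) (hne : (uncertaintySet c).Nonempty)
    (hZ : IsCompact (uncertaintySet c)) :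
    ∃ F : Fin (I + 1) → Vec dx → ℝ, (∀ i, ConvexOn ℝ univ (F i)) ∧
      (∀ i x, ∃ z ∈ uncertaintySet c, F i x = g i x z) ∧
      (∀ x, (primalWorst (fun i x z => (g i x z : EReal)) c).obj x = F 0 x) ∧
      (∀ i x, (primalWorst (fun i x z => (g i x z : EReal)) c).ineq i x = F i.succ x) ∧
      (primalWorst (fun i x z => (g i x z : EReal)) c).constraintSet =
        {x | ∀ i : Fin I, F i.succ x ≤ 0} := by
  choose F hF hFc hFz using fun i => exists_real_worstCase hne hZ (hgx i) (hgc i)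
  refine ⟨F, hFc, hFz, fun x => congrFun (hF 0) x, fun i x => congrFun (hF i.succ) x, ?_⟩
  ext x
  rw [mem_primalWorst_constraintSet_iff]
  refine forall_congr' fun i => ?_
  rw [hF i.succ]
  exact EReal.coe_nonpos

/-- Exact multipliers at a finite infimum produce a dual optimizer. If the infimum is `-∞`, weak
duality leaves the dual without feasible points, and it is solvable by convention. -/
theorem strongDuality_of_primal_slater (hgx : ∀ i z, ConvexOn ℝ univ fun x => g i x z)
    (hgz : ∀ i x, ConcaveOn ℝ univ (g i x)) (hgc : ∀ i x, UpperSemicontinuous (g i x))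
    (hc : ∀ l, IsPCC (c l)) (hne : (uncertaintySet c).Nonempty)
    (hZ : IsCompact (uncertaintySet c)) {x₀ : Vec dx}
    (hx₀ : (primalWorst (fun i x z => (g i x z : EReal)) c).IsMinStrictSlater x₀) :
    (primalWorst (fun i x z => (g i x z : EReal)) c).infimum =
        (dualBest (fun i x z => (g i x z : EReal)) c).supremum ∧
      (dualBest (fun i x z => (g i x z : EReal)) c).MaxSolvable := by
  obtain ⟨F, hFc, hFz, hobj, hineq, hcon⟩ := exists_real_primalWorst hgx hgc hne hZ
  have hweak := dualBest_supremum_le_primalWorst_infimum (g := g) (c := c)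
  have hslater : ∀ i : Fin I, F i.succ x₀ < 0 := fun i => by
    have := hx₀.1.2.2.2 i
    rw [hineq] at this
    exact_mod_cast this
  have hlt : (primalWorst (fun i x z => (g i x z : EReal)) c).infimum ≠ ⊤ := by
    refine (lt_of_le_of_lt (iInf₂_le x₀ hx₀.1.2.2.1) ?_).ne
    rw [hobj]
    exact EReal.coe_lt_top _
  by_cases hbot : (primalWorst (fun i x z => (g i x z : EReal)) c).infimum = ⊥
  · have hsup := hweak
    rw [hbot, le_bot_iff] at hsup
    refine ⟨hbot.trans hsup.symm, fun ⟨y, hy, hy'⟩ => absurd ?_ hy'⟩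
    rw [← le_bot_iff, ← hsup]
    exact le_iSup₂ (f := fun y _ => (dualBest (fun i x z => (g i x z : EReal)) c).obj y) y hy
  · obtain ⟨m, hm⟩ : ∃ m : ℝ, (primalWorst (fun i x z => (g i x z : EReal)) c).infimum = m :=
      ⟨_, (EReal.coe_toReal hlt hbot).symm⟩
    obtain ⟨l, hl, hl'⟩ := exists_lagrange_multiplier (hFc 0) (fun i : Fin I => hFc i.succ)
      hslater (m := m) (fun x hx => by
        have : (m : EReal) ≤ (primalWorst (fun i x z => (g i x z : EReal)) c).obj x :=
          hm ▸ iInf₂_le x (by rw [hcon]; exact hx)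
        rw [hobj] at this
        exact_mod_cast this)
    obtain ⟨y, hy, hmy⟩ := exists_dualBest_of_multipliers hgx hgz hgc hc hne hZ hFz hl hl'
    have hsup : (dualBest (fun i x z => (g i x z : EReal)) c).obj y ≤
        (dualBest (fun i x z => (g i x z : EReal)) c).supremum :=
      le_iSup₂ (f := fun y _ => (dualBest (fun i x z => (g i x z : EReal)) c).obj y) y hy
    rw [← hm] at hmy
    refine ⟨le_antisymm (hmy.trans hsup) hweak, fun _ => ⟨y, ⟨hy, fun h => ?_⟩,
      le_antisymm hsup (hweak.trans hmy)⟩⟩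
    rw [h, le_bot_iff] at hmy
    exact hbot hmy

theorem strongDuality_of_isBounded (hgx : ∀ i z, ConvexOn ℝ univ fun x => g i x z)
    (hgz : ∀ i x, ConcaveOn ℝ univ (g i x)) (hgc : ∀ i x, UpperSemicontinuous (g i x))
    (hc : ∀ l, IsPCC (c l)) (hne : (uncertaintySet c).Nonempty)
    (hZ : IsCompact (uncertaintySet c))
    (hfeas : (primalWorst (fun i x z => (g i x z : EReal)) c).minFeasible.Nonempty)
    (hbd : Bornology.IsBounded (primalWorst (fun i x z => (g i x z : EReal)) c).minFeasible) :
    (primalWorst (fun i x z => (g i x z : EReal)) c).infimum =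
        (dualBest (fun i x z => (g i x z : EReal)) c).supremum ∧
      (primalWorst (fun i x z => (g i x z : EReal)) c).MinSolvable := by
  obtain ⟨F, hFc, hFz, hobj, -, hcon⟩ := exists_real_primalWorst hgx hgc hne hZ
  have hweak := dualBest_supremum_le_primalWorst_infimum (g := g) (c := c)
  have hmin : (primalWorst (fun i x z => (g i x z : EReal)) c).minFeasible =
      {x | ∀ i : Fin I, F i.succ x ≤ 0} := by
    rw [← hcon]
    ext x
    exact and_iff_left (by rw [hobj]; exact EReal.coe_ne_top _)
  have hcont : ∀ i, Continuous (F i) := fun i =>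
    continuousOn_univ.1 ((hFc i).continuousOn isOpen_univ)
  rw [hmin] at hfeas hbd
  have hcpt : IsCompact {x | ∀ i : Fin I, F i.succ x ≤ 0} := by
    refine Metric.isCompact_of_isClosed_isBounded ?_ hbd
    have : {x | ∀ i : Fin I, F i.succ x ≤ 0} = ⋂ i : Fin I, {x | F i.succ x ≤ 0} := by
      ext; simp
    rw [this]
    exact isClosed_iInter fun i => isClosed_le (hcont _) continuous_const
  obtain ⟨x, hx, hxmin⟩ := hcpt.exists_isMinOn hfeas (hcont 0).continuousOn
  have hinf : (primalWorst (fun i x z => (g i x z : EReal)) c).infimum = F 0 x := by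
    refine le_antisymm ((iInf₂_le x (by rw [hcon]; exact hx)).trans (hobj x).le)
      (le_iInf₂ fun y hy => ?_)
    rw [hcon] at hy
    rw [hobj]
    exact EReal.coe_le_coe_iff.2 (hxmin hy)
  refine ⟨le_antisymm ?_ hweak, fun _ => ⟨x, by rw [hmin]; exact hx, by rw [hinf, hobj]⟩⟩
  rw [hinf]
  by_contra hlt
  -- Multipliers are available only strictly below the optimal value; this suffices to exclude a
  -- gap, but does not give dual attainment.
  obtain ⟨t, h1, h2⟩ := EReal.lt_iff_exists_real_btwn.1 (not_le.1 hlt)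
  obtain ⟨l, hl, hl'⟩ := exists_lagrange_multiplier_of_isBounded (hFc 0)
    (fun i : Fin I => hFc i.succ) hfeas hbd (fun y hy => hxmin hy) (EReal.coe_lt_coe_iff.1 h2)
  obtain ⟨y, hy, hty⟩ := exists_dualBest_of_multipliers hgx hgz hgc hc hne hZ hFz hl hl'
  exact absurd (hty.trans (le_iSup₂
    (f := fun y _ => (dualBest (fun i x z => (g i x z : EReal)) c).obj y) y hy)) (not_le.2 h1)

/-- The Slater point keeps the supremum above `-∞`. If it is `+∞`, weak duality makes the primal
infeasible; otherwise `exists_primalWorst_of_slater` applies at the supremum itself. -/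
theorem strongDuality_of_dual_slater (hgx : ∀ i z, ConvexOn ℝ univ fun x => g i x z)
    (hgz : ∀ i x, ConcaveOn ℝ univ (g i x)) (hc : ∀ l, IsPCC (c l))
    (hne : (uncertaintySet c).Nonempty) {y : DualVar I dx dz}
    (hy : (dualBest (fun i x z => (g i x z : EReal)) c).IsMaxStrictSlater y) :
    (primalWorst (fun i x z => (g i x z : EReal)) c).infimum =
        (dualBest (fun i x z => (g i x z : EReal)) c).supremum ∧
      (primalWorst (fun i x z => (g i x z : EReal)) c).MinSolvable := by
  have hweak := dualBest_supremum_le_primalWorst_infimum (g := g) (c := c)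
  have hsup : (dualBest (fun i x z => (g i x z : EReal)) c).supremum ≠ ⊥ := by
    have h1 : -(dualBest (fun i x z => (g i x z : EReal)) c).obj y < ⊤ := by
      have h := intrinsicInterior_subset hy.2
      exact h
    intro h
    have h2 : (dualBest (fun i x z => (g i x z : EReal)) c).obj y ≤ ⊥ :=
      h ▸ le_iSup₂ (f := fun y _ => (dualBest (fun i x z => (g i x z : EReal)) c).obj y) y
        hy.1.2.2.1
    rw [le_bot_iff.1 h2, EReal.neg_bot] at h1
    exact lt_irrefl _ h1
  by_cases htop : (dualBest (fun i x z => (g i x z : EReal)) c).supremum = ⊤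
  · have hinf := hweak
    rw [htop, top_le_iff] at hinf
    refine ⟨hinf.trans htop.symm, fun ⟨x, hx, hx'⟩ => absurd ?_ hx'⟩
    rw [← top_le_iff, ← hinf]
    exact iInf₂_le x hx
  · obtain ⟨v, hv⟩ : ∃ v : ℝ, (dualBest (fun i x z => (g i x z : EReal)) c).supremum = v :=
      ⟨_, (EReal.coe_toReal htop hsup).symm⟩
    obtain ⟨w, z, l⟩ := y
    obtain ⟨x, hx0, hx⟩ := exists_primalWorst_of_slater hgx hgz hc hne hy hv.le
    have hobj : (primalWorst (fun i x z => (g i x z : EReal)) c).obj x ≤ v :=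
      worstCase_coe_le_iff.2 fun z hz => EReal.coe_le_coe_iff.2 (hx0 z hz)
    have hmem : x ∈ (primalWorst (fun i x z => (g i x z : EReal)) c).constraintSet :=
      mem_primalWorst_constraintSet_iff.2 fun i => worstCase_coe_le_iff.2 fun z hz => by
        exact_mod_cast hx i z hz
    have hinf : (primalWorst (fun i x z => (g i x z : EReal)) c).infimum ≤
        (primalWorst (fun i x z => (g i x z : EReal)) c).obj x := iInf₂_le x hmem
    rw [← hv] at hobj
    refine ⟨le_antisymm (hinf.trans hobj) hweak, fun _ => ⟨x, ⟨hmem, fun h => ?_⟩,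
      le_antisymm (hobj.trans hweak) hinf⟩⟩
    rw [h, top_le_iff] at hobj
    exact htop hobj

end StrongDuality

end RobustDuality

end

theorem mainTheorem1 (I L dx dz : ℕ)
    (f : Fin (I + 1) → RobustDuality.Vec dx → RobustDuality.Vec dz → EReal)
    (hf_x : ∀ i z, RobustDuality.IsPCC (fun x => f i x z))
    (hf_z : ∀ i x, RobustDuality.IsPCC (fun z => - f i x z))
    (c : Fin L → RobustDuality.Vec dz → EReal)
    (hc : ∀ l, RobustDuality.IsPCC (c l))
    (hZ : (RobustDuality.uncertaintySet c).Nonempty) :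
    ((∃ x, (RobustDuality.primalWorst f c).IsMinStrictSlater x) →
      Bornology.IsBounded (RobustDuality.uncertaintySet c) →
        (RobustDuality.primalWorst f c).infimum = (RobustDuality.dualBest f c).supremum ∧
        (RobustDuality.dualBest f c).MaxSolvable) ∧
    ((RobustDuality.primalWorst f c).minFeasible.Nonempty →
      Bornology.IsBounded (RobustDuality.primalWorst f c).minFeasible →
      Bornology.IsBounded (RobustDuality.uncertaintySet c) →
        (RobustDuality.primalWorst f c).infimum = (RobustDuality.dualBest f c).supremum ∧
        (RobustDuality.primalWorst f c).MinSolvable) ∧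
    ((∃ y, (RobustDuality.dualBest f c).IsMaxStrictSlater y) →
        (RobustDuality.primalWorst f c).infimum = (RobustDuality.dualBest f c).supremum ∧
        (RobustDuality.primalWorst f c).MinSolvable) := by
  obtain ⟨g, rfl, hgx, hgz, hgc⟩ := RobustDuality.exists_real_saddle hf_x hf_z
  have hcpt : Bornology.IsBounded (RobustDuality.uncertaintySet c) →
      IsCompact (RobustDuality.uncertaintySet c) := fun hbd =>
    Metric.isCompact_of_isClosed_isBounded (RobustDuality.isClosed_uncertaintySet hc) hbd
  exact ⟨fun ⟨_, hx⟩ hbd =>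
      RobustDuality.strongDuality_of_primal_slater hgx hgz hgc hc hZ (hcpt hbd) hx,
    fun hfeas hfbd hbd =>
      RobustDuality.strongDuality_of_isBounded hgx hgz hgc hc hZ (hcpt hbd) hfeas hfbd,
    fun ⟨_, hy⟩ => RobustDuality.strongDuality_of_dual_slater hgx hgz hc hZ hy⟩
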